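/- For a group $G$ and $x\in G$, let $\mathrm{Sub}_G(x)=\langle g\in G \mid \langle x\rangle \text{ is subnormal in } \langle x,g\rangle\rangle$ be the subnormalizer of $x$ in $G$. Let $k\ge 3$ be an integer and let $x\in S_{2^k}$ be a $2$-element (an element whose order is a power of $2$). Then $\mathrm{Sub}_{S_{2^k}}(x)<S_{2^k}$ is a proper subgroup if and only if one of the following holds: (i) $x$ is a $2^k$-cycle; (ii) $o(x)=2^{k-1}$ and $x$ has at least one fixed point on $\{1,\dots,2^k\}$. Moreover, in case (ii), let $\Omega\subseteq\{1,\dots,2^k\}$ be the set of points lying in cycles of $x$ of length smaller than $2^{k-1}$ (fixed points included), and let $y$ be the product of all cycles of length smaller than $2^{k-1}$ in the expression of $x$ as a product of disjoint cycles, regarded as an element of $\mathrm{Sym}(\Omega)$. Then $|\Omega|=2^{k-1}$ and $$\mathrm{Sub}_{S_{2^k}}(x)=\mathrm{Sub}_{\mathrm{Sym}(\Omega)}(y)\wr S_2,$$ where, for $H\le \mathrm{Sym}(\Omega)$, $H\wr S_2\le S_{2^k}$ denotes the imprimitive wreath product with respect to a suitable bijection $e$ from $\Omega$ to its complement: it is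 generated by $H$ (acting on $\Omega$ and fixing the complement pointwise), the copy of $H$ acting on the complement of $\Omega$ via $e$, and the involution exchanging $a$ and $e(a)$ for all $a\in\Omega$. -/

import Mathlib

/-- The subnormalizer `Sub_G(x)`: the subgroup of `G` generated by all `g` such that `⟨x⟩` is a
subnormal subgroup of `⟨x, g⟩`. -/
def subnormalizer {G : Type*} [Group G] (x : G) : Subgroup G :=
  Subgroup.closure
    {g : G | ((Subgroup.zpowers x).subgroupOf (Subgroup.closure {x, g})).IsSubnormal}

/-- The product of the cycles of length smaller than `m` in the decomposition of `x` as a product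
of disjoint cycles. -/
def shortCycleProduct {α : Type*} [Fintype α] [DecidableEq α] (x : Equiv.Perm α) (m : ℕ) :
    Equiv.Perm α :=
  (x.cycleFactorsFinset.filter (fun c => c.support.card < m)).noncommProd id
    (fun _ ha _ hb hab => x.cycleFactorsFinset_mem_commute
      (Finset.mem_filter.mp ha).1 (Finset.mem_filter.mp hb).1 hab)

/-- The set of points lying in a cycle of `x` of length smaller than `m`, where a fixed point is
a cycle of length one. -/
def shortCyclePoints {α : Type*} (x : Equiv.Perm α) (m : ℕ) : Set α :=
  {a | Function.minimalPeriod x a < m}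

/-- For `H ≤ Sym(Ω)` and an identification `f` of `α` with two copies of `Ω` (indexed by the
elements of `S₂`, on which `S₂` acts by multiplication), the subgroup `H ≀ S₂` of `Sym(α)`: two
independent elements of `H` act on the two copies, and `S₂` permutes the copies. -/
def wreathS2 {Ω α : Type*} (H : Subgroup (Equiv.Perm Ω))
    (f : Ω × Equiv.Perm (Fin 2) ≃ α) : Subgroup (Equiv.Perm α) :=
  (f.permCongrHom.toMonoidHom.comp
    (RegularWreathProduct.toPerm H (Equiv.Perm (Fin 2)) Ω)).range

/-! Criterion: for a 2-element `x` of a finite group, `⟨x⟩` is subnormal in `⟨x, g⟩` exactly when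
`g` normalizes some 2-subgroup containing `x`. Hence `Sub(x)` is generated by the normalizers of
such subgroups; it contains every 2-subgroup through `x`, and a subgroup `E` bounds it as soon as `x
∈ E` and `E` contains the normalizer of each of its subgroups through `x`
(`NormalizesTwoGroup.mem_of_normalizer_le`).

Full cycle `z`: let `t` be the involution in `⟨z⟩`. If `n` normalizes `M ≤ C(t)` with `z ∈ M`, the
conjugate of `t` by `n` centralizes `z`, so it is an involution of `⟨z⟩` and equals `t`. Thus
`Sub(z) ≤ C(t)`. Passing to the orbits of `t` costs a kernel of exponent two, and induction makes
`Sub(z)` a 2-group. The full symmetric group is not one, so `Sub(z)` is proper.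

Half-length cycle `D` with a fixed point: a conjugate of `x` has a fixed point, so it cannot
exchange `D` with its complement `Ω`. With the bound above, this puts `Sub(x)` inside the stabilizer
of `{D, Ω}`, which is `Sym(Ω) ≀ S₂`. There `x = (y, z)` with `z` a full cycle. `Sub(z)` is a Sylow
2-subgroup, so the identification of `D` with `Ω` can be chosen with `y ∈ Sub(z)`. Sylow's theorem
inside `Sub(y)` then gives `Sub(x) = Sub(y) ≀ S₂` (`subnormalizer_eq_wreathSubgroup`).

All other cases: `subnormalizer_eq_top`, by induction on the degree. An invariant half of the points
on which induction applies gives all transpositions within it. Elements linking it to the other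
points come from a Sylow argument: if `G₁ ∩ G₀` has index two in `G₀ ∋ x`, a Sylow 2-subgroup of
`G₀` through `x` is not inside `G₁` (`exists_isPGroup_not_le`). -/

open Subgroup

/-! ### Subnormality of `⟨x⟩` in terms of normalized 2-subgroups -/

section Criterion

variable {G : Type*} [Group G]

/-- `g` normalizes some `2`-subgroup containing `x`. For a `2`-element `x` of a finite group this
means that `⟨x⟩` is subnormal in `⟨x, g⟩`. -/
def NormalizesTwoGroup (x g : G) : Prop :=
  ∃ N : Subgroup G, IsPGroup 2 N ∧ x ∈ N ∧ g ∈ normalizer (N : Set G)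

theorem isPGroup_zpowers_of_orderOf {p m : ℕ} {x : G} (h : orderOf x = p ^ m) :
    IsPGroup p (zpowers x) := IsPGroup.of_card (n := m) (by rw [Nat.card_zpowers, h])

/-- Subgroups of a nilpotent group are subnormal. -/
theorem isSubnormal_of_normalizerCondition [Finite G] (hG : NormalizerCondition G)
    (H : Subgroup G) : H.IsSubnormal := by
  induction H using WellFoundedGT.induction with
  | ind H ih =>
    by_cases h : H = ⊤
    · subst h; exact IsSubnormal.top
    · have hlt := hG H (lt_top_iff_ne_top.mpr h)
      exact IsSubnormal.step H _ hlt.le (ih _ hlt) normal_in_normalizer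

/-- Among the `p`-subgroups of `H` normalized by `H` there is a largest one. -/
theorem exists_greatest_normalized_pSubgroup [Finite G] (p : ℕ) (H : Subgroup G) :
    ∃ M : Subgroup G, (IsPGroup p M ∧ M ≤ H ∧ H ≤ normalizer (M : Set G)) ∧
      ∀ Q : Subgroup G, IsPGroup p Q → Q ≤ H → H ≤ normalizer (Q : Set G) → Q ≤ M := by
  obtain ⟨M, hM⟩ := (Set.toFinite {M : Subgroup G | IsPGroup p M ∧ M ≤ H ∧
    H ≤ normalizer (M : Set G)}).exists_maximal ⟨⊥, IsPGroup.of_bot, bot_le, by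
      rw [normalizer_eq_top]; exact le_top⟩
  refine ⟨M, hM.1, fun Q hQ hQH hHQ => ?_⟩
  have h : IsPGroup p (Q ⊔ M : Subgroup G) ∧ Q ⊔ M ≤ H ∧
      H ≤ normalizer ((Q ⊔ M : Subgroup G) : Set G) :=
    ⟨hQ.to_sup_of_normal_right' hM.1.1 (hQH.trans hM.1.2.2), sup_le hQH hM.1.2.1,
      (le_inf hHQ hM.1.2.2).trans (normalizer_inf_normalizer_le_normalizer_sup Q M)⟩
  exact le_sup_left.trans (hM.2 h le_sup_right)

/-- Conjugation by `g` preserves `H`, so it sends `M` to another `p`-subgroup of `H` normalized by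
`H`, and `M` is the largest of these. -/
theorem map_conj_le_of_normalizer {p : ℕ} {H M : Subgroup G}
    (hM : ∀ Q : Subgroup G, IsPGroup p Q → Q ≤ H → H ≤ normalizer (Q : Set G) → Q ≤ M)
    (hMp : IsPGroup p M) (hMH : M ≤ H) (hHM : H ≤ normalizer (M : Set G)) {g : G}
    (hg : g ∈ normalizer (H : Set G)) : M.map (MulAut.conj g).toMonoidHom ≤ M := by
  have hg' : H.map (MulAut.conj g).toMonoidHom = H := mem_normalizer_iff_map_conj_eq.mp hg
  refine hM _ (hMp.map _) ?_ ?_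
  · conv_rhs => rw [← hg']
    exact map_mono hMH
  · calc H = H.map (MulAut.conj g).toMonoidHom := hg'.symm
      _ ≤ (normalizer (M : Set G)).map _ := map_mono hHM
      _ ≤ _ := le_normalizer_map _

/-- A normal `p`-subgroup of a subnormal subgroup lies in a normal `p`-subgroup. -/
theorem Subgroup.IsSubnormal.exists_normal_isPGroup [Finite G] {p : ℕ} {H : Subgroup G}
    (hH : H.IsSubnormal) {P : Subgroup G} (hP : IsPGroup p P) (hPH : P ≤ H)
    (hHP : H ≤ normalizer (P : Set G)) :
    ∃ N : Subgroup G, N.Normal ∧ IsPGroup p N ∧ P ≤ N := by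
  induction hH generalizing P with
  | top => exact ⟨P, normalizer_eq_top_iff.mp (top_le_iff.mp hHP), hP, le_rfl⟩
  | step H K hle hK hN ih =>
    -- `K` need not normalize `P`, but it normalizes the greatest candidate `M`, which contains `P`.
    obtain ⟨M, ⟨hMp, hMH, hHM⟩, hM⟩ := exists_greatest_normalized_pSubgroup p H
    have hKH := (normal_subgroupOf_iff_le_normalizer hle).mp hN
    obtain ⟨N, hN, hNp, hMN⟩ := ih hMp (hMH.trans hle) (le_normalizer_iff.mpr fun k hk m hm =>
      map_conj_le_of_normalizer hM hMp hMH hHM (hKH hk) ⟨m, hm, rfl⟩)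
    exact ⟨N, hN, hNp, (hM P hP hPH hHP).trans hMN⟩

/-- Forward: a subnormal 2-subgroup lies in a normal one. Backward: `⟨x⟩` is subnormal in the
nilpotent group `N ∩ ⟨x, g⟩`, which is normal in `⟨x, g⟩`. -/
theorem isSubnormal_iff_normalizesTwoGroup [Finite G] {x : G} (hx : IsPGroup 2 (zpowers x))
    (g : G) : ((zpowers x).subgroupOf (closure {x, g})).IsSubnormal ↔
      NormalizesTwoGroup x g := by
  have hxH : x ∈ closure {x, g} := subset_closure (by simp)
  have hle : zpowers x ≤ closure {x, g} := by rwa [zpowers_le]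
  constructor
  · intro h
    obtain ⟨N, hN, hNp, hxN⟩ := h.exists_normal_isPGroup (p := 2)
      (P := (zpowers x).subgroupOf (closure {x, g}))
      (hx.of_equiv (subgroupOfEquivOfLe hle).symm) le_rfl le_normalizer
    refine ⟨N.map (closure {x, g}).subtype, hNp.map _, ⟨⟨x, hxH⟩, hxN ?_, rfl⟩,
      le_normalizer_map _ ⟨⟨g, subset_closure (by simp)⟩, ?_, rfl⟩⟩
    · exact mem_subgroupOf.mpr (mem_zpowers x)
    · rw [normalizer_eq_top]; trivial
  · rintro ⟨N, hN, hxN, hg⟩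
    have hHN : closure {x, g} ≤ normalizer (N : Set G) := by
      rw [closure_le]
      rintro y (rfl | rfl)
      exacts [le_normalizer hxN, hg]
    have hnil : IsPGroup 2 (N.subgroupOf (closure {x, g})) :=
      hN.comap_of_injective _ (subtype_injective _)
    have := hnil.isNilpotent
    refine IsSubnormal.trans (K := N.subgroupOf (closure {x, g}))
      (fun y hy => (zpowers_le.mpr hxN : zpowers x ≤ N) hy)
      (isSubnormal_of_normalizerCondition Group.normalizerCondition_of_isNilpotent _) ?_
    exact (normal_subgroupOf_of_le_normalizer hHN).isSubnormal

theorem subnormalizer_eq_closure [Finite G] {x : G} (hx : IsPGroup 2 (zpowers x)) :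
    subnormalizer x = closure {g | NormalizesTwoGroup x g} := by
  simp only [subnormalizer, isSubnormal_iff_normalizesTwoGroup hx]

theorem NormalizesTwoGroup.mem_subnormalizer [Finite G] {x g : G} (h : NormalizesTwoGroup x g) :
    g ∈ subnormalizer x := by
  obtain ⟨N, hN, hxN, hg⟩ := h
  rw [subnormalizer_eq_closure (hN.to_le (zpowers_le.mpr hxN))]
  exact subset_closure ⟨N, hN, hxN, hg⟩

theorem NormalizesTwoGroup.of_mem {x g : G} {N : Subgroup G} (hN : IsPGroup 2 N) (hx : x ∈ N)
    (hg : g ∈ N) : NormalizesTwoGroup x g := ⟨N, hN, hx, le_normalizer hg⟩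

theorem le_subnormalizer_of_isPGroup [Finite G] {x : G} {N : Subgroup G} (hN : IsPGroup 2 N)
    (hx : x ∈ N) : N ≤ subnormalizer x :=
  fun _ hg => (NormalizesTwoGroup.of_mem hN hx hg).mem_subnormalizer

theorem NormalizesTwoGroup.map {G' : Type*} [Group G'] (φ : G →* G') {x g : G}
    (h : NormalizesTwoGroup x g) : NormalizesTwoGroup (φ x) (φ g) := by
  obtain ⟨N, hN, hxN, hg⟩ := h
  exact ⟨N.map φ, hN.map φ, mem_map_of_mem φ hxN, le_normalizer_map φ (mem_map_of_mem φ hg)⟩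

theorem NormalizesTwoGroup.comap {G' : Type*} [Group G'] {φ : G →* G'}
    (hφ : Function.Injective φ) {x g : G} (h : NormalizesTwoGroup (φ x) (φ g)) :
    NormalizesTwoGroup x g := by
  obtain ⟨N, hN, hxN, hg⟩ := h
  exact ⟨N.comap φ, hN.comap_of_injective φ hφ, hxN, le_normalizer_comap φ hg⟩

/-- To bound the subnormalizer by `E` it suffices that `E` absorbs the normalizers of its
subgroups containing `x`. -/
theorem NormalizesTwoGroup.mem_of_normalizer_le [Finite G] {x g : G} {E : Subgroup G} (hxE : x ∈ E)
    (hE : ∀ M ≤ E, x ∈ M → normalizer (M : Set G) ≤ E) (h : NormalizesTwoGroup x g) : g ∈ E := by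
  obtain ⟨N, hN, hxN, hg⟩ := h
  have := hN.isNilpotent
  refine hE N ?_ hxN hg
  -- Normalizers grow in the nilpotent group `N`: if `N` were not inside `E`, some element of `N`
  -- outside `E` would normalize `N ⊓ E`, against `hE`.
  by_contra hNE
  have hlt := Group.normalizerCondition_of_isNilpotent (G := N) (E.subgroupOf N)
    (lt_top_iff_ne_top.mpr (by rwa [Ne, subgroupOf_eq_top]))
  obtain ⟨n, hn, hnE⟩ := SetLike.exists_of_lt hlt
  refine hnE (mem_subgroupOf.mpr (hE (N ⊓ E) inf_le_right ⟨hxN, hxE⟩ ?_))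
  have := le_normalizer_map N.subtype (mem_map_of_mem N.subtype hn)
  rwa [subgroupOf_map_subtype, inf_comm] at this

end Criterion

/-! ### Full cycles: the subnormalizer is a 2-group -/

section FullCycle

variable {α : Type*}

/-- The powers of `z` act transitively. -/
def IsFullCycle (z : Equiv.Perm α) : Prop := ∀ a b, ∃ i : ℤ, (z ^ i) a = b

/-- A permutation commuting with a transitive group is determined by the image of one point. -/
theorem IsFullCycle.mem_zpowers_of_commute {z h : Equiv.Perm α} (hz : IsFullCycle z)
    (hh : Commute h z) : h ∈ zpowers z := by
  rcases isEmpty_or_nonempty α with _ | ⟨⟨a⟩⟩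
  · rw [Subsingleton.elim h 1]; exact one_mem _
  obtain ⟨i, hi⟩ := hz a (h a)
  refine ⟨i, Equiv.ext fun b => ?_⟩
  obtain ⟨j, rfl⟩ := hz a b
  have h1 := congrArg (fun s : Equiv.Perm α => s a) (hh.zpow_right j).eq
  have h2 := congrArg (fun s : Equiv.Perm α => s a) ((Commute.refl z).zpow_zpow i j).eq
  simp only [Equiv.Perm.mul_apply] at h1 h2
  rw [h1, ← hi, h2]

theorem eq_of_mem_zpowers_of_sq_eq_one {G : Type*} [Group G] {z s : G} {m : ℕ}
    (hz : z ^ 2 ^ (m + 1) = 1) (ht : z ^ 2 ^ m ≠ 1) (hs : s ∈ zpowers z) (hs1 : s ≠ 1)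
    (hs2 : s ^ 2 = 1) : s = z ^ 2 ^ m := by
  have ho : orderOf z = 2 ^ (m + 1) := orderOf_eq_prime_pow ht hz
  obtain ⟨i, rfl⟩ := hs
  simp only at hs1 hs2 ⊢
  rw [← zpow_natCast, ← zpow_mul, ← orderOf_dvd_iff_zpow_eq_one, ho] at hs2
  push_cast at hs2
  rw [pow_succ, mul_dvd_mul_iff_right (by norm_num)] at hs2
  obtain ⟨j, rfl⟩ := hs2
  rcases Int.even_or_odd' j with ⟨l, rfl | rfl⟩
  · refine absurd ?_ hs1
    rw [← orderOf_dvd_iff_zpow_eq_one, ho]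
    exact ⟨l, by push_cast; ring⟩
  · have : z ^ ((2 : ℤ) ^ (m + 1)) = 1 := by exact_mod_cast hz
    rw [show (2 : ℤ) ^ m * (2 * l + 1) = 2 ^ (m + 1) * l + 2 ^ m by ring, zpow_add, zpow_mul,
      this, one_zpow, one_mul]
    exact_mod_cast rfl

/-- The normalizer of a subgroup of `C(t)` containing the full cycle `z` centralizes the
involution `t` of `⟨z⟩`. -/
theorem IsFullCycle.commute_of_normalizesTwoGroup [Finite α] {z g : Equiv.Perm α}
    (hz : IsFullCycle z) {m : ℕ} (hz1 : z ^ 2 ^ (m + 1) = 1) (ht : z ^ 2 ^ m ≠ 1)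
    (hg : NormalizesTwoGroup z g) : g ∈ centralizer {z ^ 2 ^ m} := by
  refine hg.mem_of_normalizer_le (mem_centralizer_singleton_iff.mpr
    (Commute.pow_self z _).symm) fun M hM hzM n hn => ?_
  have hconj : ∀ w ∈ M, Commute (n * z ^ 2 ^ m * n⁻¹) w := fun w hw => by
    have h1 : n⁻¹ * w * n ∈ M := (mem_normalizer_iff''.mp hn w).mp hw
    have h2 : Commute (z ^ 2 ^ m) (n⁻¹ * w * n) :=
      (mem_centralizer_singleton_iff.mp (hM h1)).symm
    have h3 := h2.map (MulAut.conj n)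
    simpa [mul_assoc] using h3
  -- The conjugate of `t` commutes with `z`, hence is a power of `z`; the cyclic group `⟨z⟩` has
  -- only one involution.
  have hs : n * z ^ 2 ^ m * n⁻¹ = z ^ 2 ^ m := by
    refine eq_of_mem_zpowers_of_sq_eq_one hz1 ht (hz.mem_zpowers_of_commute (hconj z hzM))
      ?_ ?_
    · simpa using ht
    · rw [conj_pow, ← pow_mul, ← pow_succ, hz1, mul_one, mul_inv_cancel]
  rw [mem_centralizer_singleton_iff]
  rwa [mul_inv_eq_iff_eq_mul] at hs

/-- The equivalence relation whose classes are the orbits of an involution. -/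
def involutionSetoid (t : Equiv.Perm α) (ht : t * t = 1) : Setoid α where
  r a b := b = a ∨ b = t a
  iseqv := by
    have h : ∀ a, t (t a) = a := fun a => by rw [← Equiv.Perm.mul_apply, ht]; rfl
    refine ⟨fun a => Or.inl rfl, ?_, ?_⟩
    · rintro a b (rfl | rfl)
      exacts [Or.inl rfl, Or.inr (h a).symm]
    · rintro a b c (rfl | rfl) (rfl | rfl)
      exacts [Or.inl rfl, Or.inr rfl, Or.inr rfl, Or.inl (h a)]

/-- The action of the centralizer of an involution on its orbits. -/
def centralizerToPermQuotient (t : Equiv.Perm α) (ht : t * t = 1) :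
    centralizer {t} →* Equiv.Perm (Quotient (involutionSetoid t ht)) where
  toFun g := Quotient.congr g.1 fun a b => by
    have h : g.1 (t a) = t (g.1 a) :=
      congrArg (fun s : Equiv.Perm α => s a) (mem_centralizer_singleton_iff.mp g.2)
    change (b = a ∨ b = t a) ↔ (g.1 b = g.1 a ∨ g.1 b = t (g.1 a))
    rw [← h, g.1.apply_eq_iff_eq, g.1.apply_eq_iff_eq]
  map_one' := by ext q; induction q using Quotient.inductionOn; rfl
  map_mul' _ _ := by ext q; induction q using Quotient.inductionOn; rfl

theorem centralizerToPermQuotient_mk (t : Equiv.Perm α) (ht : t * t = 1) (g : centralizer {t})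
    (a : α) : centralizerToPermQuotient t ht g (Quotient.mk _ a) = Quotient.mk _ (g.1 a) := rfl

/-- An element of the kernel acts on each orbit `{a, t a}` as the identity or as `t`. -/
theorem sq_eq_one_of_centralizerToPermQuotient_eq_one {t : Equiv.Perm α} {ht : t * t = 1}
    {g : centralizer {t}} (hg : centralizerToPermQuotient t ht g = 1) : g ^ 2 = 1 := by
  refine Subtype.ext (Equiv.ext fun a => ?_)
  have h : ∀ a, t (t a) = a := fun a => congrArg (fun s : Equiv.Perm α => s a) ht
  have hc : g.1 (t a) = t (g.1 a) :=
    congrArg (fun s : Equiv.Perm α => s a) (mem_centralizer_singleton_iff.mp g.2)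
  have h0 : Quotient.mk (involutionSetoid t ht) (g.1 a) = Quotient.mk _ a := by
    rw [← centralizerToPermQuotient_mk, hg]; rfl
  have h1 : a = g.1 a ∨ a = t (g.1 a) := Quotient.exact h0
  change (g.1 ^ 2) a = a
  rw [pow_two, Equiv.Perm.mul_apply]
  rcases h1 with h1 | h1
  · rw [← h1, ← h1]
  · have h2 : g.1 a = t a := by rw [← h (g.1 a), ← h1]
    rw [h2, hc, ← h1]

/-- The subnormalizer of a full cycle of `2`-power order is a `2`-group. -/
theorem IsFullCycle.isPGroup_subnormalizer.{u} (m : ℕ) : ∀ {α : Type u} [Finite α]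
    {z : Equiv.Perm α}, IsFullCycle z → z ^ 2 ^ m = 1 → IsPGroup 2 (subnormalizer z) := by
  induction m with
  | zero =>
    intro α _ z hz hz1
    have : Subsingleton (Equiv.Perm α) := ⟨fun g h => Equiv.ext fun a => by
      obtain ⟨i, hi⟩ := hz (g a) (h a)
      rw [← hi, show z = 1 by simpa using hz1, one_zpow, Equiv.Perm.one_apply]⟩
    exact IsPGroup.of_subsingleton _ _
  | succ m ih =>
    intro α _ z hz hz1
    by_cases ht : z ^ 2 ^ m = 1
    · exact ih hz ht
    have hz2 : IsPGroup 2 (zpowers z) :=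
      isPGroup_zpowers_of_orderOf (orderOf_eq_prime_pow ht hz1)
    have htt : z ^ 2 ^ m * z ^ 2 ^ m = 1 := by rw [← pow_two, ← pow_mul, ← pow_succ, hz1]
    set φ := centralizerToPermQuotient (z ^ 2 ^ m) htt
    have hzc : z ∈ centralizer {z ^ 2 ^ m} :=
      mem_centralizer_singleton_iff.mpr (Commute.pow_self z _).symm
    set z' : centralizer {z ^ 2 ^ m} := ⟨z, hzc⟩
    have hfull : IsFullCycle (φ z') := by
      intro a b
      induction a using Quotient.inductionOn with | h a =>
      induction b using Quotient.inductionOn with | h b =>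
      obtain ⟨i, rfl⟩ := hz a b
      exact ⟨i, by rw [← map_zpow]; rfl⟩
    have hpow : φ z' ^ 2 ^ m = 1 := by
      rw [← map_pow]
      ext q
      induction q using Quotient.inductionOn with | h a =>
      exact Quotient.sound (Or.inr (congrArg (fun s : Equiv.Perm α => s a) htt).symm)
    have hQ := ih hfull hpow
    have hle : subnormalizer z ≤
        (((subnormalizer (φ z')).comap φ).map (centralizer {z ^ 2 ^ m}).subtype) := by
      rw [subnormalizer_eq_closure hz2, closure_le]
      intro g hg
      have hgc := hz.commute_of_normalizesTwoGroup hz1 ht hg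
      refine ⟨⟨g, hgc⟩, ?_, rfl⟩
      have : NormalizesTwoGroup z' ⟨g, hgc⟩ :=
        NormalizesTwoGroup.comap (φ := (centralizer {z ^ 2 ^ m}).subtype)
          (subtype_injective _) hg
      exact (this.map φ).mem_subnormalizer
    refine IsPGroup.to_le (IsPGroup.map (hQ.comap_of_ker_isPGroup φ ?_) _) hle
    rintro ⟨g, hg⟩
    exact ⟨1, Subtype.ext (by
      simpa using sq_eq_one_of_centralizerToPermQuotient_eq_one (MonoidHom.mem_ker.mp hg))⟩

end FullCycle

/-! ### Subnormalizers in `A ≀ S₂` -/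

section Wreath

open RegularWreathProduct

variable {A : Type*} [Group A]

theorem self_mem_subnormalizer (x : A) : x ∈ subnormalizer x := by
  refine subset_closure ?_
  have h : (zpowers x).subgroupOf (closure {x, x}) = ⊤ := by
    rw [subgroupOf_eq_top, Set.pair_eq_singleton, zpowers_eq_closure]
  simp only [Set.mem_ofPred_eq, h, IsSubnormal.top]

/-- By the criterion, `Sub(z)` is self-normalizing when it is itself a 2-group through `z`. -/
theorem mem_subnormalizer_of_mem_normalizer [Finite A] {z n : A}
    (hz : IsPGroup 2 (subnormalizer z))
    (hn : n ∈ normalizer (subnormalizer z : Set A)) : n ∈ subnormalizer z :=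
  NormalizesTwoGroup.mem_subnormalizer ⟨_, hz, self_mem_subnormalizer z, hn⟩

/-- A subnormalizer that is a `2`-group is a Sylow subgroup. -/
def sylowSubnormalizer [Finite A] {z : A} (hz : IsPGroup 2 (subnormalizer z)) : Sylow 2 A where
  toSubgroup := subnormalizer z
  isPGroup' := hz
  is_maximal' hQ hle :=
    (le_subnormalizer_of_isPGroup hQ (hle (self_mem_subnormalizer z))).antisymm hle

/-- If the `2`-group `Sub(z)` contains `y` and its conjugate by `u`, then `u ∈ Sub(y)`. -/
theorem mem_subnormalizer_of_conj_mem [Finite A] {y z u : A} (hz : IsPGroup 2 (subnormalizer z))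
    (hy : y ∈ subnormalizer z) (hu : u * y * u⁻¹ ∈ subnormalizer z) : u ∈ subnormalizer y := by
  set Q := sylowSubnormalizer hz
  have hQ : (Q : Subgroup A) ≤ subnormalizer y := le_subnormalizer_of_isPGroup hz hy
  have hQu : ((u⁻¹ • Q : Sylow 2 A) : Subgroup A) ≤ subnormalizer y := by
    refine le_subnormalizer_of_isPGroup (u⁻¹ • Q : Sylow 2 A).2 ?_
    refine ⟨u * y * u⁻¹, hu, ?_⟩
    simp [mul_assoc]
  -- `Q` and its conjugate by `u⁻¹` both contain `y`, so both are Sylow subgroups of `Sub(y)`,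
  -- conjugate there by `h`. Then `h u⁻¹` normalizes `Q`, which is self-normalizing and inside
  -- `Sub(y)`.
  obtain ⟨h, hh⟩ := MulAction.exists_smul_eq (subnormalizer y) ((u⁻¹ • Q).subtype hQu)
    (Q.subtype hQ)
  simp_rw [Sylow.smul_subtype, Subgroup.smul_def, smul_smul] at hh
  have h1 : (h : A) * u⁻¹ ∈ subnormalizer z := mem_subnormalizer_of_mem_normalizer hz
    (Sylow.smul_eq_iff_mem_normalizer.mp (Sylow.subtype_injective hh))
  have h2 := mul_mem (inv_mem (hQ h1)) h.2
  simpa using h2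

theorem isPGroup_prod {B : Type*} [Group B] {p : ℕ} {H : Subgroup A} {K : Subgroup B}
    (hH : IsPGroup p H) (hK : IsPGroup p K) : IsPGroup p (H.prod K) := by
  rintro ⟨⟨a, b⟩, ha, hb⟩
  obtain ⟨i, hi⟩ := hH ⟨a, ha⟩
  obtain ⟨j, hj⟩ := hK ⟨b, hb⟩
  have hi' : a ^ p ^ i = 1 := congrArg Subtype.val hi
  have hj' : b ^ p ^ j = 1 := congrArg Subtype.val hj
  refine ⟨i + j, Subtype.ext (Prod.ext ?_ ?_)⟩
  · change a ^ p ^ (i + j) = 1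
    rw [pow_add, pow_mul, hi', one_pow]
  · change b ^ p ^ (i + j) = 1
    rw [add_comm, pow_add, pow_mul, hj', one_pow]

/-- If `g` normalizes a `2`-group containing `y`, so does its image for the image of `(y, z)`. -/
theorem NormalizesTwoGroup.map_prod {B G : Type*} [Group B] [Group G] (ψ : A × B →* G) {y g : A}
    {z : B} (hz : IsPGroup 2 (zpowers z)) (h : NormalizesTwoGroup y g) :
    NormalizesTwoGroup (ψ (y, z)) (ψ (g, 1)) := by
  obtain ⟨N, hN, hy, hg⟩ := h
  refine NormalizesTwoGroup.map ψ ⟨N.prod (zpowers z), isPGroup_prod hN hz,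
    ⟨hy, mem_zpowers z⟩, ?_⟩
  rw [mem_normalizer_iff] at hg ⊢
  rintro ⟨a, b⟩
  simp only [mem_prod, Prod.fst_mul, Prod.snd_mul, Prod.fst_inv, Prod.snd_inv, hg a, one_mul,
    inv_one, mul_one]

theorem perm_fin_two_eq_or (q : Equiv.Perm (Fin 2)) : q = 1 ∨ q = Equiv.swap 0 1 := by
  revert q; decide

theorem perm_fin_two_ne : (Equiv.swap 0 1 : Equiv.Perm (Fin 2)) ≠ 1 := by decide

theorem perm_fin_two_mul_self (q : Equiv.Perm (Fin 2)) : q * q = 1 := by revert q; decide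

/-- The elements of `A ≀ S₂` whose two components lie in `H`. -/
def wreathSubgroup (H : Subgroup A) : Subgroup (A ≀ᵣ Equiv.Perm (Fin 2)) where
  carrier := {w | ∀ r, w.left r ∈ H}
  mul_mem' ha hb r := mul_mem (ha r) (hb _)
  one_mem' _ := one_mem H
  inv_mem' ha _ := inv_mem (ha _)

theorem left_pow_of_right_eq_one {w : A ≀ᵣ Equiv.Perm (Fin 2)} (hw : w.right = 1) (n : ℕ) :
    (w ^ n).right = 1 ∧ ∀ r, (w ^ n).left r = w.left r ^ n := by
  induction n with
  | zero => simp
  | succ n ih => simp [pow_succ, ih, hw]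

theorem isPGroup_wreathSubgroup [Finite A] {H : Subgroup A} (hH : IsPGroup 2 H) :
    IsPGroup 2 (wreathSubgroup H) := by
  obtain ⟨n, hn⟩ := isPGroup_iff_exists_pow_pow_eq_one.mp hH
  rintro ⟨w, hw⟩
  have h2 : (w * w).right = 1 := by rw [mul_right, perm_fin_two_mul_self]
  have hw2 : w * w ∈ wreathSubgroup H := mul_mem hw hw
  obtain ⟨h3, h4⟩ := left_pow_of_right_eq_one h2 (2 ^ n)
  refine ⟨n + 1, Subtype.ext ?_⟩
  change w ^ 2 ^ (n + 1) = 1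
  rw [pow_succ', pow_mul, pow_two]
  refine RegularWreathProduct.ext (funext fun r => ?_) h3
  rw [h4]
  exact congrArg Subtype.val (hn ⟨_, hw2 r⟩)

/-- The component homomorphisms on the base group of `A ≀ S₂`. -/
def baseComponent (r : Equiv.Perm (Fin 2)) :
    (rightHom : A ≀ᵣ Equiv.Perm (Fin 2) →* _).ker →* A where
  toFun w := w.1.left r
  map_one' := rfl
  map_mul' a b := by
    have ha : a.1.right = 1 := a.2
    simp [ha]

/-- The embedding of `A × A` as the base group of `A ≀ S₂`. -/
def baseInclusion : A × A →* A ≀ᵣ Equiv.Perm (Fin 2) where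
  toFun p := ⟨fun r => if r = 1 then p.1 else p.2, 1⟩
  map_one' := RegularWreathProduct.ext (funext fun r => by simp) rfl
  map_mul' a b := RegularWreathProduct.ext (funext fun r => by
    by_cases h : r = 1 <;> simp [h]) (by simp)

theorem NormalizesTwoGroup.left {x g : A ≀ᵣ Equiv.Perm (Fin 2)} (h : NormalizesTwoGroup x g)
    (hx : x.right = 1) (hg : g.right = 1) (r : Equiv.Perm (Fin 2)) :
    NormalizesTwoGroup (x.left r) (g.left r) := by
  have h' : NormalizesTwoGroup (⟨x, hx⟩ : (rightHom : A ≀ᵣ Equiv.Perm (Fin 2) →* _).ker) ⟨g, hg⟩ :=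
    NormalizesTwoGroup.comap (φ := (rightHom : A ≀ᵣ Equiv.Perm (Fin 2) →* _).ker.subtype)
      (subtype_injective _) h
  exact h'.map (baseComponent r)

/-- Write `x = (y, z)`. When `g` exchanges the factors, two elements of the base group replace it:
`g x g⁻¹ ∈ N`, whose second component is a conjugate of `y`, and `g²`, whose second component is the
product of the components of `g`. -/
theorem mem_wreathSubgroup_of_normalizesTwoGroup [Finite A] {x g : A ≀ᵣ Equiv.Perm (Fin 2)}
    (hx : x.right = 1) (hz : IsPGroup 2 (subnormalizer (x.left (Equiv.swap 0 1))))
    (hy : x.left 1 ∈ subnormalizer (x.left (Equiv.swap 0 1))) (h : NormalizesTwoGroup x g) :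
    g ∈ wreathSubgroup (subnormalizer (x.left 1)) := by
  have hle := le_subnormalizer_of_isPGroup hz hy
  rcases perm_fin_two_eq_or g.right with hg | hg
  · intro r
    have h1 := (h.left hx hg r).mem_subnormalizer
    rcases perm_fin_two_eq_or r with rfl | rfl
    exacts [h1, hle h1]
  · have hs : g.left (Equiv.swap 0 1) ∈ subnormalizer (x.left 1) := by
      refine mem_subnormalizer_of_conj_mem hz hy ?_
      obtain ⟨N, hN, hxN, hgN⟩ := h
      have h1 : NormalizesTwoGroup x (g * x * g⁻¹) :=
        .of_mem hN hxN ((mem_normalizer_iff.mp hgN x).mp hxN)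
      have h2 := (h1.left hx (by simp [hx]) (Equiv.swap 0 1)).mem_subnormalizer
      simpa [hx, hg] using h2
    have h1 : g.left (Equiv.swap 0 1) * g.left 1 ∈ subnormalizer (x.left 1) := by
      obtain ⟨N, hN, hxN, hgN⟩ := h
      have h1 : NormalizesTwoGroup x (g * g) := ⟨N, hN, hxN, mul_mem hgN hgN⟩
      have h2 := (h1.left hx (by simp [perm_fin_two_mul_self]) (Equiv.swap 0 1)).mem_subnormalizer
      simpa [hg] using hle h2
    intro r
    rcases perm_fin_two_eq_or r with rfl | rfl
    · simpa using mul_mem (inv_mem hs) h1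
    · exact hs

theorem wreathSubgroup_le_subnormalizer [Finite A] {x : A ≀ᵣ Equiv.Perm (Fin 2)}
    (hx : x.right = 1) (hz : IsPGroup 2 (subnormalizer (x.left (Equiv.swap 0 1))))
    (hy : x.left 1 ∈ subnormalizer (x.left (Equiv.swap 0 1))) :
    wreathSubgroup (subnormalizer (x.left 1)) ≤ subnormalizer x := by
  set y := x.left 1 with hydef
  set z := x.left (Equiv.swap 0 1) with hzdef
  have hxe : x = baseInclusion (y, z) := by
    refine RegularWreathProduct.ext (funext fun r => ?_) hx
    rcases perm_fin_two_eq_or r with rfl | rfl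
    · simp [baseInclusion, hydef]
    · simp [baseInclusion, hzdef]
  -- The exchange of the factors lies in `Sub(z) ≀ S₂`, a 2-group containing `x = (y, z)`.
  have hs : (inl (Equiv.swap 0 1) : A ≀ᵣ Equiv.Perm (Fin 2)) ∈ subnormalizer x := by
    refine le_subnormalizer_of_isPGroup (isPGroup_wreathSubgroup hz) ?_ fun r => one_mem _
    intro r
    rcases perm_fin_two_eq_or r with rfl | rfl
    exacts [hy, self_mem_subnormalizer z]
  have hbase : subnormalizer y ≤
      (subnormalizer x).comap (baseInclusion.comp (MonoidHom.inl A A)) := by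
    rw [subnormalizer_eq_closure (hz.to_le (zpowers_le.mpr hy)), closure_le]
    intro g hg
    have := hg.map_prod baseInclusion (z := z)
      (hz.to_le (zpowers_le.mpr (self_mem_subnormalizer z)))
    rw [← hxe] at this
    exact this.mem_subnormalizer
  have hker : ∀ w ∈ wreathSubgroup (subnormalizer y), w.right = 1 → w ∈ subnormalizer x := by
    intro w hw hw1
    have h1 := mem_comap.mp (hbase (hw 1))
    have h2 := mem_comap.mp (hbase (hw (Equiv.swap 0 1)))
    have h3 := mul_mem h1 (mul_mem hs (mul_mem h2 hs))
    convert h3 using 1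
    refine RegularWreathProduct.ext (funext fun r => ?_) ?_
    · rcases perm_fin_two_eq_or r with rfl | rfl <;> simp [baseInclusion]
    · simp [baseInclusion, hw1]
  intro w hw
  rcases perm_fin_two_eq_or w.right with h | h
  · exact hker w hw h
  · have h1 := hker (w * inl (Equiv.swap 0 1)) (fun r => by simpa using hw r) (by simp [h])
    have h2 := mul_mem h1 (inv_mem hs)
    simpa using h2

theorem subnormalizer_eq_wreathSubgroup [Finite A] {x : A ≀ᵣ Equiv.Perm (Fin 2)}
    (hx : x.right = 1) (hz : IsPGroup 2 (subnormalizer (x.left (Equiv.swap 0 1))))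
    (hy : x.left 1 ∈ subnormalizer (x.left (Equiv.swap 0 1))) (hx2 : IsPGroup 2 (zpowers x)) :
    subnormalizer x = wreathSubgroup (subnormalizer (x.left 1)) := by
  refine le_antisymm ?_ (wreathSubgroup_le_subnormalizer hx hz hy)
  rw [subnormalizer_eq_closure hx2, closure_le]
  exact fun g hg => mem_wreathSubgroup_of_normalizesTwoGroup hx hz hy hg

theorem subnormalizer_map_of_injective {B : Type*} [Group B] [Finite A] [Finite B] {φ : A →* B}
    (hφ : Function.Injective φ) {x : A} (hx : IsPGroup 2 (zpowers (φ x)))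
    (h : ∀ g, NormalizesTwoGroup (φ x) g → g ∈ φ.range) :
    subnormalizer (φ x) = (subnormalizer x).map φ := by
  have hx' : IsPGroup 2 (zpowers x) :=
    (hx.comap_of_injective φ hφ).to_le (zpowers_le.mpr (mem_zpowers (φ x)))
  rw [subnormalizer_eq_closure hx, subnormalizer_eq_closure hx', MonoidHom.map_closure]
  congr 1
  ext g
  constructor
  · intro hg
    obtain ⟨g, rfl⟩ := h g hg
    exact ⟨g, hg.comap hφ, rfl⟩
  · rintro ⟨g, hg, rfl⟩
    exact hg.map φ

theorem wreathS2_eq_map {Ω α : Type*} (H : Subgroup (Equiv.Perm Ω))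
    (f : Ω × Equiv.Perm (Fin 2) ≃ α) :
    wreathS2 H f = (wreathSubgroup H).map (f.permCongrHom.toMonoidHom.comp
      (toPerm (Equiv.Perm Ω) (Equiv.Perm (Fin 2)) Ω)) := by
  ext σ
  constructor
  · rintro ⟨w, rfl⟩
    exact ⟨⟨fun r => w.left r, w.right⟩, fun r => (w.left r).2, rfl⟩
  · rintro ⟨w, hw, rfl⟩
    exact ⟨⟨fun r => ⟨w.left r, hw r⟩, w.right⟩, rfl⟩

end Wreath

/-! ### Transpositions and Sylow arguments in symmetric groups -/

section PermTools

variable {α : Type*}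

theorem swap_conj_mem [DecidableEq α] {K : Subgroup (Equiv.Perm α)} {σ : Equiv.Perm α} {a b : α}
    (hσ : σ ∈ K) (h : Equiv.swap a b ∈ K) : Equiv.swap (σ a) (σ b) ∈ K := by
  rw [Equiv.swap_apply_apply]
  exact mul_mem (mul_mem hσ h) (inv_mem hσ)

theorem swap_mem_trans [DecidableEq α] {K : Subgroup (Equiv.Perm α)} {a b c : α}
    (hab : Equiv.swap a b ∈ K) (hbc : Equiv.swap b c ∈ K) : Equiv.swap a c ∈ K := by
  by_cases hca : c = a
  · subst hca; rw [Equiv.swap_self]; exact one_mem K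
  by_cases hcb : c = b
  · subst hcb; exact hab
  simpa [Equiv.swap_apply_of_ne_of_ne hca hcb] using swap_conj_mem hab hbc

theorem eq_top_of_forall_swap_mem [Finite α] [DecidableEq α] {K : Subgroup (Equiv.Perm α)} (a : α)
    (h : ∀ b, Equiv.swap a b ∈ K) : K = ⊤ := by
  rw [eq_top_iff, ← Equiv.Perm.closure_isSwap, closure_le]
  rintro σ ⟨b, c, -, rfl⟩
  exact swap_mem_trans (Equiv.swap_comm a b ▸ h b) (h c)

/-- If `x ∈ G₀` is a `2`-element and `G₁ ∩ G₀` has index two in `G₀`, then some `2`-subgroup of `G₀`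
containing `x` is not contained in `G₁`. -/
theorem exists_isPGroup_not_le {G : Type*} [Group G] [Finite G] {G₀ G₁ : Subgroup G} {x t : G}
    (hx : IsPGroup 2 (zpowers x)) (hx0 : x ∈ G₀) (ht : t ∈ G₀) (ht1 : t ∉ G₁)
    (h : ∀ a ∈ G₀, ∀ b ∈ G₀, a ∉ G₁ → b ∉ G₁ → a * b ∈ G₁) :
    ∃ P : Subgroup G, IsPGroup 2 P ∧ x ∈ P ∧ ∃ σ ∈ P, σ ∈ G₀ ∧ σ ∉ G₁ := by
  have hx' : IsPGroup 2 ((zpowers x).subgroupOf G₀) :=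
    hx.comap_of_injective _ (subtype_injective _)
  obtain ⟨Q, hQ⟩ := hx'.exists_le_sylow
  refine ⟨Q.1.map G₀.subtype, Q.2.map _, ⟨⟨x, hx0⟩, hQ (mem_zpowers x), rfl⟩, ?_⟩
  by_contra! hcon
  have hle : Q.1 ≤ G₁.subgroupOf G₀ := fun q hq => hcon q ⟨q, hq, rfl⟩ q.2
  have hidx : (G₁.subgroupOf G₀).index = 2 := by
    rw [index_eq_two_iff]
    refine ⟨⟨t, ht⟩, fun b => ?_⟩
    by_cases hb : (b : G) ∈ G₁
    · exact Or.inr ⟨hb, fun hbt => ht1 (by simpa using mul_mem (inv_mem hb) hbt)⟩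
    · exact Or.inl ⟨h _ b.2 _ ht hb ht1, hb⟩
  -- A Sylow 2-subgroup inside a subgroup of index two would have even index.
  have hdvd := index_dvd_of_le hle
  rw [hidx] at hdvd
  exact Q.not_dvd_index hdvd

theorem subtypeCongrHom_mk_one (p : α → Prop) [DecidablePred p] (g : Equiv.Perm {a // p a}) :
    Equiv.Perm.subtypeCongrHom p (g, 1) = Equiv.Perm.ofSubtype g := by
  ext a
  by_cases ha : p a
  · simp [ha, Equiv.Perm.ofSubtype_apply_of_mem]
  · simp [ha, Equiv.Perm.ofSubtype_apply_of_not_mem]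

theorem isPGroup_zpowers_of_pow_eq_one {G : Type*} [Group G] {x : G} {p k : ℕ}
    (h : x ^ p ^ k = 1) : IsPGroup p (zpowers x) := by
  rintro ⟨_, i, rfl⟩
  refine ⟨k, Subtype.ext ?_⟩
  change (x ^ i) ^ p ^ k = 1
  rw [← zpow_natCast, ← zpow_mul, mul_comm, zpow_mul, zpow_natCast, h, one_zpow]

theorem isPGroup_zpowers_subtypePerm {p : α → Prop} {x : Equiv.Perm α}
    (hp : ∀ a, p (x a) ↔ p a) (hx : IsPGroup 2 (zpowers x)) :
    IsPGroup 2 (zpowers (x.subtypePerm hp)) := by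
  obtain ⟨k, hk⟩ := hx ⟨x, mem_zpowers x⟩
  have hk' : x ^ 2 ^ k = 1 := congrArg Subtype.val hk
  have : x.subtypePerm hp ^ 2 ^ k = 1 := by
    rw [Equiv.Perm.subtypePerm_pow]
    ext a
    simp [hk']
  exact isPGroup_zpowers_of_pow_eq_one this

/-- The subnormalizer of the restriction of `x` to an invariant set embeds into that of `x`. -/
theorem ofSubtype_mem_subnormalizer [Finite α] {p : α → Prop} [DecidablePred p]
    {x : Equiv.Perm α} (hp : ∀ a, p (x a) ↔ p a) (hx : IsPGroup 2 (zpowers x))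
    {g : Equiv.Perm {a // p a}} (hg : g ∈ subnormalizer (x.subtypePerm hp)) :
    Equiv.Perm.ofSubtype g ∈ subnormalizer x := by
  have hp' : ∀ a, ¬ p (x a) ↔ ¬ p a := fun a => not_congr (hp a)
  have hle : subnormalizer (x.subtypePerm hp) ≤
      (subnormalizer x).comap (Equiv.Perm.ofSubtype : Equiv.Perm {a // p a} →* _) := by
    rw [subnormalizer_eq_closure (isPGroup_zpowers_subtypePerm hp hx), closure_le]
    intro g hg
    have h := (hg.map_prod (Equiv.Perm.subtypeCongrHom p)
      (isPGroup_zpowers_subtypePerm hp' hx)).mem_subnormalizer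
    rw [subtypeCongrHom_mk_one] at h
    have hxe : Equiv.Perm.subtypeCongrHom p (x.subtypePerm hp, x.subtypePerm hp') = x := by
      ext a
      by_cases ha : p a <;> simp [ha]
    rwa [hxe] at h
  exact hle hg

theorem swap_mem_of_subnormalizer_subtypePerm_eq_top [Finite α] [DecidableEq α] {p : α → Prop}
    {x : Equiv.Perm α} (hp : ∀ a, p (x a) ↔ p a) (hx : IsPGroup 2 (zpowers x))
    (h : subnormalizer (x.subtypePerm hp) = ⊤) {a b : α} (ha : p a) (hb : p b) :
    Equiv.swap a b ∈ subnormalizer x := by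
  classical
  have := ofSubtype_mem_subnormalizer hp hx
    (g := Equiv.swap ⟨a, ha⟩ ⟨b, hb⟩) (h ▸ mem_top _)
  rwa [Equiv.Perm.ofSubtype_swap_eq] at this

/-- The permutations commuting with `e` that map each `c` to `c` or `e c`. -/
def fiberSubgroup (e : Equiv.Perm α) (he : ∀ c, e (e c) = c) : Subgroup (Equiv.Perm α) where
  carrier := {g | (∀ c, g c = c ∨ g c = e c) ∧ ∀ c, g (e c) = e (g c)}
  one_mem' := ⟨fun _ => Or.inl rfl, fun _ => rfl⟩
  mul_mem' := by
    rintro g h ⟨hg, hg'⟩ ⟨hh, hh'⟩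
    refine ⟨fun c => ?_, fun c => ?_⟩
    · rw [Equiv.Perm.mul_apply]
      rcases hh c with h1 | h1 <;> rcases hg c with h2 | h2 <;> simp [h1, h2, hg', he]
    · simp [hg', hh']
  inv_mem' := by
    rintro g ⟨hg, hg'⟩
    refine ⟨fun c => ?_, fun c => ?_⟩
    · rw [Equiv.Perm.inv_eq_iff_eq, Equiv.Perm.inv_eq_iff_eq, hg']
      rcases hg c with h2 | h2 <;> simp [h2, he]
    · rw [Equiv.Perm.inv_eq_iff_eq, hg']; simp

theorem isPGroup_fiberSubgroup (e : Equiv.Perm α) (he : ∀ c, e (e c) = c) :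
    IsPGroup 2 (fiberSubgroup e he) := by
  rintro ⟨g, hg, hg'⟩
  refine ⟨1, Subtype.ext (Equiv.ext fun c => ?_)⟩
  change (g ^ 2 ^ 1) c = c
  rw [pow_one, pow_two, Equiv.Perm.mul_apply]
  rcases hg c with h2 | h2 <;> simp [h2, he, hg']

/-- The permutations flipping arbitrary pairs `{c, e c}` form a group of exponent dividing two. It
is normalized by `x`, which commutes with `e`, so together with `⟨x⟩` it generates a 2-group. -/
theorem swap_mem_subnormalizer_of_commute [Finite α] [DecidableEq α] {x e : Equiv.Perm α}
    (hx : IsPGroup 2 (zpowers x)) (he : ∀ c, e (e c) = c) (hxe : ∀ c, x (e c) = e (x c)) (a : α) :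
    Equiv.swap a (e a) ∈ subnormalizer x := by
  have hN : IsPGroup 2 (fiberSubgroup e he ⊔ zpowers x : Subgroup (Equiv.Perm α)) := by
    refine (isPGroup_fiberSubgroup e he).to_sup_of_normal_left' hx ?_
    have hxe' : ∀ c, x.symm (e c) = e (x.symm c) := fun c => by
      rw [Equiv.symm_apply_eq, hxe, Equiv.apply_symm_apply]
    rw [zpowers_le, mem_normalizer_iff]
    refine fun g => ⟨fun ⟨h1, h2⟩ => ⟨fun c => ?_, fun c => ?_⟩,
      fun ⟨h1, h2⟩ => ⟨fun c => ?_, fun c => ?_⟩⟩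
    · rcases h1 (x.symm c) with h | h <;> simp [h, hxe]
    · simp [hxe', h2, hxe]
    · rcases h1 (x c) with h | h
      · left; simpa using h
      · right
        rw [← hxe] at h
        simpa using h
    · have := h2 (x c)
      rw [← hxe] at this
      simpa [← hxe] using this
  refine le_subnormalizer_of_isPGroup hN (mem_sup_right (mem_zpowers x))
    (mem_sup_left ⟨fun c => ?_, fun c => ?_⟩)
  · by_cases h1 : c = a
    · subst h1; simp
    by_cases h2 : c = e a
    · subst h2; simp [he]
    · simp [Equiv.swap_apply_of_ne_of_ne h1 h2]
  · by_cases h1 : c = a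
    · subst h1; simp [he]
    by_cases h2 : c = e a
    · subst h2; simp [he]
    · rw [Equiv.swap_apply_of_ne_of_ne h1 h2, Equiv.swap_apply_of_ne_of_ne]
      · rintro rfl; exact h2 (he c).symm
      · exact fun h => h1 (e.injective h)

/-- Points of distinct cycles of equal length are interchanged by an element of the
subnormalizer. -/
theorem swap_mem_subnormalizer_of_period_eq [Finite α] [DecidableEq α] {x : Equiv.Perm α}
    (hx : IsPGroup 2 (zpowers x)) {a b : α} (hab : ∀ i : ℤ, (x ^ i) a = a ↔ (x ^ i) b = b)
    (hne : ¬ x.SameCycle a b) : Equiv.swap a b ∈ subnormalizer x := by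
  classical
  have key : ∀ i j : ℤ, (x ^ i) a = (x ^ j) a ↔ (x ^ i) b = (x ^ j) b := fun i j => by
    have h : ∀ c, (x ^ i) c = (x ^ j) c ↔ (x ^ (-j + i)) c = c := fun c => by
      rw [zpow_add, Equiv.Perm.mul_apply, zpow_neg, Equiv.Perm.inv_eq_iff_eq]
    rw [h, h, hab]
  have hne' : ∀ i j : ℤ, (x ^ i) a ≠ (x ^ j) b := fun i j h =>
    hne ⟨-j + i, by rw [zpow_add, Equiv.Perm.mul_apply, h, zpow_neg]; simp⟩
  -- `f` exchanges `x^i a` with `x^i b`; `key` makes it independent of the exponent chosen, and it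
  -- commutes with `x`.
  let f : α → α := fun c =>
    if h : ∃ i : ℤ, (x ^ i) a = c then (x ^ h.choose) b
    else if h : ∃ i : ℤ, (x ^ i) b = c then (x ^ h.choose) a else c
  have fa : ∀ i : ℤ, f ((x ^ i) a) = (x ^ i) b := fun i => by
    have h : ∃ j : ℤ, (x ^ j) a = (x ^ i) a := ⟨i, rfl⟩
    simp only [f, dif_pos h]
    exact (key _ _).mp h.choose_spec
  have fb : ∀ i : ℤ, f ((x ^ i) b) = (x ^ i) a := fun i => by
    have h0 : ¬ ∃ j : ℤ, (x ^ j) a = (x ^ i) b := fun ⟨j, hj⟩ => hne' j i hj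
    have h : ∃ j : ℤ, (x ^ j) b = (x ^ i) b := ⟨i, rfl⟩
    simp only [f, dif_neg h0, dif_pos h]
    exact (key _ _).mpr h.choose_spec
  have fc : ∀ c, (¬ ∃ i : ℤ, (x ^ i) a = c) → (¬ ∃ i : ℤ, (x ^ i) b = c) → f c = c :=
    fun c h1 h2 => by simp only [f, dif_neg h1, dif_neg h2]
  have hx1 : ∀ (i : ℤ) c, x ((x ^ i) c) = (x ^ (i + 1)) c := fun i c => by
    rw [add_comm, zpow_add, zpow_one, Equiv.Perm.mul_apply]
  have hshift : ∀ c d, (∃ i : ℤ, (x ^ i) d = x c) → ∃ i : ℤ, (x ^ i) d = c := by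
    rintro c d ⟨i, hi⟩
    exact ⟨-1 + i, by rw [zpow_add, Equiv.Perm.mul_apply, hi, zpow_neg_one]; simp⟩
  have hf : Function.Involutive f := fun c => by
    by_cases h1 : ∃ i : ℤ, (x ^ i) a = c
    · obtain ⟨i, rfl⟩ := h1; rw [fa, fb]
    by_cases h2 : ∃ i : ℤ, (x ^ i) b = c
    · obtain ⟨i, rfl⟩ := h2; rw [fb, fa]
    rw [fc c h1 h2, fc c h1 h2]
  have := swap_mem_subnormalizer_of_commute (e := hf.toPerm f) hx hf (fun c => ?_) a
  · have h0 : hf.toPerm f a = b := by simpa using fa 0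
    rwa [h0] at this
  · change x (f c) = f (x c)
    by_cases h1 : ∃ i : ℤ, (x ^ i) a = c
    · obtain ⟨i, rfl⟩ := h1; rw [fa, hx1, hx1, fa]
    by_cases h2 : ∃ i : ℤ, (x ^ i) b = c
    · obtain ⟨i, rfl⟩ := h2; rw [fb, hx1, hx1, fb]
    rw [fc c h1 h2, fc (x c) (fun h => h1 (hshift c a h)) (fun h => h2 (hshift c b h))]

/-- Disjoint sets of equal size are interchanged by a permutation fixing all other points. -/
theorem exists_perm_interchanging [Finite α] {X Y : Set α} (hd : Disjoint X Y)
    (hc : X.ncard = Y.ncard) : ∃ t : Equiv.Perm α, (∀ a ∈ X, t a ∈ Y) ∧ (∀ a ∈ Y, t a ∈ X) ∧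
      ∀ a, a ∉ X → a ∉ Y → t a = a := by
  classical
  obtain ⟨e⟩ : Nonempty (X ≃ Y) := Finite.card_eq.mp (by simpa [Set.ncard] using hc)
  let f : α → α := fun c => if h : c ∈ X then e ⟨c, h⟩ else
    if h : c ∈ Y then e.symm ⟨c, h⟩ else c
  have fX : ∀ c (h : c ∈ X), f c = e ⟨c, h⟩ := fun c h => dif_pos h
  have fY : ∀ c (h : c ∈ Y), f c = e.symm ⟨c, h⟩ := fun c h => by
    have h0 : c ∉ X := fun h' => Set.disjoint_left.mp hd h' h
    simp only [f, dif_neg h0, dif_pos h]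
  have fn : ∀ c, c ∉ X → c ∉ Y → f c = c := fun c h1 h2 => by
    simp only [f, dif_neg h1, dif_neg h2]
  have hf : Function.Involutive f := fun c => by
    by_cases h1 : c ∈ X
    · rw [fX c h1, fY _ (e ⟨c, h1⟩).2]; simp
    by_cases h2 : c ∈ Y
    · rw [fY c h2, fX _ (e.symm ⟨c, h2⟩).2]; simp
    rw [fn c h1 h2, fn c h1 h2]
  refine ⟨hf.toPerm f, fun a ha => ?_, fun a ha => ?_, fn⟩
  · change f a ∈ Y; rw [fX a ha]; exact (e _).2
  · change f a ∈ X; rw [fY a ha]; exact (e.symm _).2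

end PermTools

/-! ### Cycle lengths, invariant sets and alternating colourings -/

section Cycles

variable {α : Type*}

theorem ncard_sameCycle (x : Equiv.Perm α) (a : α) :
    {b | x.SameCycle a b}.ncard = Function.minimalPeriod x a := by
  have h : {b | x.SameCycle a b} = MulAction.orbit (zpowers x) a := by
    ext b
    constructor
    · rintro ⟨i, rfl⟩; exact ⟨⟨x ^ i, i, rfl⟩, rfl⟩
    · rintro ⟨⟨_, i, rfl⟩, rfl⟩; exact ⟨i, rfl⟩
  rw [h, ← Nat.card_coe_set_eq, Nat.card_congr (MulAction.orbitZPowersEquiv x a), Nat.card_zmod]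
  rfl

theorem zpow_apply_eq_self_iff (x : Equiv.Perm α) (a : α) (i : ℤ) :
    (x ^ i) a = a ↔ (Function.minimalPeriod x a : ℤ) ∣ i :=
  MulAction.zpow_smul_eq_iff_minimalPeriod_dvd (a := x) (b := a)

theorem minimalPeriod_eq_two_pow {x : Equiv.Perm α} {a : α} {j : ℕ} (h0 : (x ^ 2 ^ j) a ≠ a)
    (h1 : (x ^ 2 ^ (j + 1)) a = a) : Function.minimalPeriod x a = 2 ^ (j + 1) := by
  refine Function.minimalPeriod_eq_prime_pow (p := 2) ?_ ?_
  · rwa [Function.IsPeriodicPt, Function.IsFixedPt, Equiv.Perm.iterate_eq_pow]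
  · rwa [Function.IsPeriodicPt, Function.IsFixedPt, Equiv.Perm.iterate_eq_pow]

theorem apply_zpow_mem_iff {x : Equiv.Perm α} {X : Set α} (hX : ∀ a, x a ∈ X ↔ a ∈ X) (i : ℤ)
    (a : α) : (x ^ i) a ∈ X ↔ a ∈ X := by
  induction i with
  | zero => rfl
  | succ i ih => rw [add_comm, zpow_add, Equiv.Perm.mul_apply, zpow_one, hX, ih]
  | pred i ih =>
    rw [← hX, ← Equiv.Perm.mul_apply, ← zpow_one_add, ← ih]
    congr! 3
    ring

/-- If `x` acts on the invariant set `X` with all cycle lengths dividing `2 ^ j`, then `X` has an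
invariant subset of size `2 ^ j`, unless it is too small. -/
theorem exists_invariant_subset [Finite α] {x : Equiv.Perm α} (j : ℕ) : ∀ {X : Set α},
    (∀ a, x a ∈ X ↔ a ∈ X) → (∀ a ∈ X, (x ^ 2 ^ j) a = a) → 2 ^ j ≤ X.ncard →
    ∃ Y ⊆ X, (∀ a, x a ∈ Y ↔ a ∈ Y) ∧ Y.ncard = 2 ^ j := by
  induction j with
  | zero =>
    intro X hX h1 hc
    obtain ⟨a, ha⟩ : X.Nonempty := (Set.ncard_pos).mp (by rw [pow_zero] at hc; lia)
    have hxa : x a = a := by simpa using h1 a ha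
    refine ⟨{a}, by simpa using ha, fun b => ?_, by simp⟩
    rw [Set.mem_singleton_iff, Set.mem_singleton_iff]
    constructor
    · intro h; exact x.injective (h.trans hxa.symm)
    · rintro rfl; exact hxa
  | succ j ih =>
    intro X hX h1 hc
    -- Either some cycle in `X` has exactly the required length, or all lengths divide `2 ^ j` and
    -- two disjoint invariant sets of half the size are united.
    by_cases hex : ∃ a ∈ X, (x ^ 2 ^ j) a ≠ a
    · obtain ⟨a, ha, hne⟩ := hex
      refine ⟨{b | x.SameCycle a b}, ?_, fun b => Equiv.Perm.sameCycle_apply_right, ?_⟩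
      · rintro _ ⟨i, rfl⟩
        exact (apply_zpow_mem_iff hX i a).mpr ha
      · rw [ncard_sameCycle, minimalPeriod_eq_two_pow hne (h1 a ha)]
    · push Not at hex
      obtain ⟨Y, hYX, hY, hYc⟩ := ih hX hex (le_trans (Nat.pow_le_pow_right two_pos (by lia)) hc)
      have hd : (X \ Y).ncard = X.ncard - Y.ncard := Set.ncard_sdiff hYX
      obtain ⟨Z, hZX, hZ, hZc⟩ := ih (X := X \ Y) (fun a => by
        simp only [Set.mem_sdiff, hX, hY]) (fun a ha => hex a ha.1) (by
          rw [hd, hYc]; rw [pow_succ] at hc; lia)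
      refine ⟨Y ∪ Z, Set.union_subset hYX (hZX.trans Set.sdiff_subset), fun a => ?_, ?_⟩
      · simp only [Set.mem_union, hY, hZ]
      · rw [Set.ncard_union_eq (Set.disjoint_left.mpr fun a ha haZ => (hZX haZ).2 ha), hYc, hZc,
          pow_succ]
        ring

theorem exists_minimalPeriod_eq_two_pow {x : Equiv.Perm α} (hx : IsPGroup 2 (zpowers x)) (a : α) :
    ∃ m, Function.minimalPeriod x a = 2 ^ m := by
  obtain ⟨k, hk⟩ := hx ⟨x, mem_zpowers x⟩
  have hk' : x ^ 2 ^ k = 1 := congrArg Subtype.val hk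
  have h1 : Function.minimalPeriod x a ∣ 2 ^ k := by
    have := (zpow_apply_eq_self_iff x a ((2 ^ k : ℕ) : ℤ)).mp (by rw [zpow_natCast, hk']; rfl)
    exact_mod_cast this
  obtain ⟨m, -, hm⟩ := (Nat.dvd_prime_pow Nat.prime_two).mp h1
  exact ⟨m, hm⟩

/-- A fixed-point-free `2`-element admits a two-colouring of the points that it reverses. -/
theorem exists_alternating_colouring {x : Equiv.Perm α} (hx : IsPGroup 2 (zpowers x))
    (hfix : ∀ a, x a ≠ a) : ∃ c : α → ZMod 2, ∀ a, c (x a) = c a + 1 := by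
  have heven : ∀ a (i : ℤ), (x ^ i) a = a → ((i : ℤ) : ZMod 2) = 0 := fun a i hi => by
    rw [zpow_apply_eq_self_iff] at hi
    obtain ⟨m, hm⟩ := exists_minimalPeriod_eq_two_pow hx a
    cases m with
    | zero =>
      refine absurd ?_ (hfix a)
      have := (zpow_apply_eq_self_iff x a 1).mpr (by simp [hm])
      simpa using this
    | succ m =>
      rw [ZMod.intCast_zmod_eq_zero_iff_dvd]
      refine dvd_trans ?_ hi
      rw [hm, pow_succ]
      exact ⟨2 ^ m, by push_cast; ring⟩
  -- The colour is the parity of the exponent from a base point of the cycle, well defined by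
  -- `heven` since all cycles have even length.
  let s := Equiv.Perm.SameCycle.setoid x
  have hrep : ∀ a, ∃ i : ℤ, (x ^ i) (Quotient.mk s a).out = a := fun a => Quotient.mk_out (s := s) a
  choose n hn using hrep
  refine ⟨fun a => (n a : ZMod 2), fun a => ?_⟩
  have hq : Quotient.mk s (x a) = Quotient.mk s a :=
    Quotient.sound (s := s) (Equiv.Perm.sameCycle_apply_left.mpr (Equiv.Perm.SameCycle.refl x a))
  have h1 := hn (x a)
  rw [hq] at h1
  have h2 : (x ^ (-(n a + 1) + n (x a))) (Quotient.mk s a).out = (Quotient.mk s a).out := by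
    rw [zpow_add, Equiv.Perm.mul_apply, h1, zpow_neg, Equiv.Perm.inv_eq_iff_eq, add_comm,
      zpow_add, Equiv.Perm.mul_apply, hn a, zpow_one]
  have h3 := heven _ _ h2
  push_cast at h3
  linear_combination h3

/-- `x` exchanges the two colour classes of `X`. -/
theorem two_mul_ncard_colour_class [Finite α] {x : Equiv.Perm α} {c : α → ZMod 2}
    (hc : ∀ a, c (x a) = c a + 1) {X : Set α} (hX : ∀ a, x a ∈ X ↔ a ∈ X) :
    2 * {a | a ∈ X ∧ c a = 1}.ncard = X.ncard := by
  have h01 : ∀ r : ZMod 2, r = 0 ∨ r = 1 := by decide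
  have h1 : x '' {a | a ∈ X ∧ c a = 1} = {a | a ∈ X ∧ c a = 0} := by
    ext a
    constructor
    · rintro ⟨b, ⟨hb, hcb⟩, rfl⟩
      exact ⟨(hX b).mpr hb, by rw [hc, hcb]; decide⟩
    · rintro ⟨ha, hca⟩
      refine ⟨x.symm a, ⟨(hX _).mp (by simpa using ha), ?_⟩, by simp⟩
      have := hc (x.symm a)
      rw [Equiv.apply_symm_apply, hca] at this
      rcases h01 (c (x.symm a)) with h | h
      · rw [h] at this; exact absurd this (by decide)
      · exact h
  have h2 := Set.ncard_image_of_injective {a | a ∈ X ∧ c a = 1} x.injective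
  have h3 : {a | a ∈ X ∧ c a = 1} ∪ {a | a ∈ X ∧ c a = 0} = X := by
    ext a
    constructor
    · rintro (h | h) <;> exact h.1
    · intro h
      rcases h01 (c a) with h' | h'
      exacts [Or.inr ⟨h, h'⟩, Or.inl ⟨h, h'⟩]
  have h4 := Set.ncard_union_eq (s := {a | a ∈ X ∧ c a = 1}) (t := {a | a ∈ X ∧ c a = 0})
    (Set.disjoint_left.mpr fun a ha hb => by
      have := ha.2.symm.trans hb.2
      exact absurd this (by decide))
  rw [h3, ← h1, h2] at h4
  lia

end Cycles

/-! ### Elements with full subnormalizer -/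

section FullSubnormalizer

open scoped Pointwise

variable {α : Type*}

theorem smul_set_eq_of_forall_mem [Finite α] {X Y : Set α} {t : Equiv.Perm α}
    (h : ∀ a ∈ X, t a ∈ Y) (hc : X.ncard = Y.ncard) : t • X = Y := by
  refine Set.eq_of_subset_of_ncard_le ?_ ?_
  · rintro _ ⟨a, ha, rfl⟩; exact h a ha
  · rw [← hc]
    exact (Set.ncard_image_of_injective X t.injective).ge

theorem smul_set_eq_self_of_invariant {X : Set α} {x : Equiv.Perm α}
    (h : ∀ a, x a ∈ X ↔ a ∈ X) : x • X = X := by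
  ext a
  rw [Set.mem_smul_set_iff_inv_smul_mem, ← h]
  simp

/-- If `x` stabilizes `X`, `Y` and `Z`, where `Y` and `Z` have equal size, then the
subnormalizer of `x` contains an element that stabilizes `X` and maps `Y` onto `Z`. -/
theorem exists_mem_subnormalizer_smul_eq [Finite α] {x : Equiv.Perm α}
    (hx : IsPGroup 2 (zpowers x)) {X Y Z : Set α} (hX : x • X = X) (hY : x • Y = Y)
    (hZ : x • Z = Z) (hXY : Disjoint X Y) (hXZ : Disjoint X Z) (hYZ : Disjoint Y Z)
    (hne : Y.Nonempty) (hc : Y.ncard = Z.ncard) :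
    ∃ σ ∈ subnormalizer x, σ • X = X ∧ σ • Y = Z := by
  obtain ⟨t, htY, htZ, ht⟩ := exists_perm_interchanging hYZ hc
  have hYne : Y ≠ Z := hYZ.ne hne.ne_empty
  have hG : ∀ g : Equiv.Perm α, g ∈ MulAction.stabilizer (Equiv.Perm α) ({Y, Z} : Set (Set α)) →
      g ∉ MulAction.stabilizer (Equiv.Perm α) Y → g • Y = Z ∧ g • Z = Y := by
    intro g hg hgY
    rw [MulAction.mem_stabilizer_iff] at hg hgY
    rw [Set.smul_set_insert, Set.smul_set_singleton, Set.pair_eq_pair_iff] at hg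
    rcases hg with hg | hg
    exacts [absurd hg.1 hgY, hg]
  obtain ⟨P, hP, hxP, σ, hσP, hσ0, hσ1⟩ := exists_isPGroup_not_le
    (G₀ := MulAction.stabilizer (Equiv.Perm α) X ⊓
      MulAction.stabilizer (Equiv.Perm α) ({Y, Z} : Set (Set α)))
    (G₁ := MulAction.stabilizer (Equiv.Perm α) Y) (t := t) hx
    (mem_inf.mpr ⟨hX, by
      rw [MulAction.mem_stabilizer_iff, Set.smul_set_insert, Set.smul_set_singleton, hY, hZ]⟩)
    (mem_inf.mpr ⟨smul_set_eq_of_forall_mem (fun a ha => by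
        rwa [ht a (Set.disjoint_left.mp hXY ha) (Set.disjoint_left.mp hXZ ha)]) rfl, by
      rw [MulAction.mem_stabilizer_iff, Set.smul_set_insert, Set.smul_set_singleton,
        smul_set_eq_of_forall_mem htY hc, smul_set_eq_of_forall_mem htZ hc.symm, Set.pair_comm]⟩)
    (fun h => hYne (h.symm.trans (smul_set_eq_of_forall_mem htY hc)))
    (fun a ha b hb ha1 hb1 => by
      rw [MulAction.mem_stabilizer_iff, mul_smul, (hG b hb.2 hb1).1, (hG a ha.2 ha1).2])
  exact ⟨σ, le_subnormalizer_of_isPGroup hP hxP hσP, hσ0.1, (hG σ hσ0.2 hσ1).1⟩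

/-- The permutations acting on the values of `(c, p)` by `c ↦ c + ν`, `p ↦ p + l c + μ`. -/
def affineColourSubgroup (c p : α → ZMod 2) : Subgroup (Equiv.Perm α) where
  carrier := {g | ∃ ν l μ : ZMod 2, (∀ a, c (g a) = c a + ν) ∧ ∀ a, p (g a) = p a + l * c a + μ}
  one_mem' := ⟨0, 0, 0, fun a => by simp, fun a => by simp⟩
  mul_mem' := by
    rintro g h ⟨ν, l, μ, h1, h2⟩ ⟨ν', l', μ', h1', h2'⟩
    refine ⟨ν + ν', l + l', μ + μ' + l * ν', fun a => ?_, fun a => ?_⟩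
    · rw [Equiv.Perm.mul_apply, h1, h1']; ring
    · rw [Equiv.Perm.mul_apply, h2, h2', h1']; ring
  inv_mem' := by
    rintro g ⟨ν, l, μ, h1, h2⟩
    have h3 : ∀ a, c (g⁻¹ a) = c a - ν := fun a => by
      have := h1 (g⁻¹ a)
      rw [← Equiv.Perm.mul_apply, mul_inv_cancel, Equiv.Perm.one_apply] at this
      linear_combination -this
    refine ⟨-ν, -l, l * ν - μ, fun a => ?_, fun a => ?_⟩
    · rw [h3]; ring
    · have := h2 (g⁻¹ a)
      rw [← Equiv.Perm.mul_apply, mul_inv_cancel, Equiv.Perm.one_apply, h3] at this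
      linear_combination -this

/-- The permutations acting on the values of `p` by translations. -/
def translationColourSubgroup (p : α → ZMod 2) : Subgroup (Equiv.Perm α) where
  carrier := {g | ∃ μ : ZMod 2, ∀ a, p (g a) = p a + μ}
  one_mem' := ⟨0, fun a => by simp⟩
  mul_mem' := by
    rintro g h ⟨μ, h2⟩ ⟨μ', h2'⟩
    exact ⟨μ + μ', fun a => by rw [Equiv.Perm.mul_apply, h2, h2']; ring⟩
  inv_mem' := by
    rintro g ⟨μ, h2⟩
    refine ⟨-μ, fun a => ?_⟩
    have := h2 (g⁻¹ a)
    rw [← Equiv.Perm.mul_apply, mul_inv_cancel, Equiv.Perm.one_apply] at this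
    linear_combination -this

/-- If the fixed-point-free `2`-element `x` stabilizes `X` and the complement of `X` has the same
size, then the subnormalizer contains an element mapping one of `u`, `x u` into `X` and the other
out of `X`, for each `u ∈ X`. -/
theorem exists_mem_subnormalizer_splitting [Finite α] {x : Equiv.Perm α}
    (hx : IsPGroup 2 (zpowers x)) (hfix : ∀ a, x a ≠ a) {X : Set α} (hX : ∀ a, x a ∈ X ↔ a ∈ X)
    (hc : X.ncard = Xᶜ.ncard) {u : α} (hu : u ∈ X) :
    ∃ σ ∈ subnormalizer x, (σ u ∈ X ∧ σ (x u) ∉ X) ∨ (σ u ∉ X ∧ σ (x u) ∈ X) := by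
  classical
  have h01 : ∀ r : ZMod 2, r = 0 ∨ r = 1 := by decide
  obtain ⟨c, hcx⟩ := exists_alternating_colouring hx hfix
  let p : α → ZMod 2 := fun a => if a ∈ X then 0 else 1
  have p0 : ∀ a, a ∈ X → p a = 0 := fun a h => if_pos h
  have p1 : ∀ a, a ∉ X → p a = 1 := fun a h => if_neg h
  have hcard : {a | a ∈ X ∧ c a = 1}.ncard = {a | a ∈ Xᶜ ∧ c a = 1}.ncard := by
    have h1 := two_mul_ncard_colour_class hcx hX
    have h2 := two_mul_ncard_colour_class hcx (X := Xᶜ) (fun a => not_congr (hX a))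
    lia
  -- `t` flips `p` exactly on the points of colour one, so it is affine with `l = 1`. Products of
  -- two such elements have `l = 0`, so the translations have index two in the affine group.
  obtain ⟨t, ht1, ht2, ht3⟩ := exists_perm_interchanging
    (Set.disjoint_left.mpr fun a ha hb => hb.1 ha.1) hcard
  have htfix : ∀ a, c a = 0 → t a = a := fun a ha =>
    ht3 a (fun h => by have := ha.symm.trans h.2; exact absurd this (by decide))
      (fun h => by have := ha.symm.trans h.2; exact absurd this (by decide))
  have htp : ∀ a, c a = 1 → p (t a) = p a + 1 := fun a ha => by
    by_cases h : a ∈ X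
    · rw [p0 a h, p1 _ (ht1 a ⟨h, ha⟩).1]; decide
    · rw [p1 a h, p0 _ (ht2 a ⟨h, ha⟩).1]; decide
  have ht0 : t ∈ affineColourSubgroup c p := by
    refine ⟨0, 1, 0, fun a => ?_, fun a => ?_⟩
    · rcases h01 (c a) with h | h
      · rw [htfix a h, add_zero]
      · rw [h, add_zero]
        by_cases h' : a ∈ X
        exacts [(ht1 a ⟨h', h⟩).2, (ht2 a ⟨h', h⟩).2]
    · rcases h01 (c a) with h | h
      · rw [htfix a h, h]; ring
      · rw [htp a h, h]; ring
  have htn : t ∉ translationColourSubgroup p := by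
    rintro ⟨μ, hμ⟩
    have key : ∀ v w, c v = 0 → c w = 1 → False := fun v w hv hw => by
      have h1 := hμ v
      rw [htfix v hv] at h1
      have h2 := hμ w
      rw [htp w hw] at h2
      have h3 : (1 : ZMod 2) = 0 := by linear_combination h2 - h1
      exact absurd h3 (by decide)
    rcases h01 (c u) with h | h
    · exact key u (x u) h (by rw [hcx, h]; decide)
    · exact key (x u) u (by rw [hcx, h]; decide) h
  have hout : ∀ g ∈ affineColourSubgroup c p, g ∉ translationColourSubgroup p →
      ∃ ν μ : ZMod 2, (∀ a, c (g a) = c a + ν) ∧ ∀ a, p (g a) = p a + c a + μ := by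
    rintro g ⟨ν, l, μ, h1, h2⟩ hg
    rcases h01 l with rfl | rfl
    · exact absurd ⟨μ, fun a => by rw [h2]; ring⟩ hg
    · exact ⟨ν, μ, h1, fun a => by rw [h2]; ring⟩
  obtain ⟨P, hP, hxP, σ, hσP, hσ0, hσ1⟩ := exists_isPGroup_not_le hx
    (G₀ := affineColourSubgroup c p) (G₁ := translationColourSubgroup p)
    ⟨1, 0, 0, hcx, fun a => by simp [p, hX]⟩ ht0 htn
    (fun g hg h hh hg1 hh1 => by
      obtain ⟨ν, μ, h1, h2⟩ := hout g hg hg1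
      obtain ⟨ν', μ', h1', h2'⟩ := hout h hh hh1
      refine ⟨μ + μ' + ν', fun a => ?_⟩
      rw [Equiv.Perm.mul_apply, h2, h2', h1']
      linear_combination CharTwo.add_self_eq_zero (c a))
  obtain ⟨ν, μ, h1, h2⟩ := hout σ hσ0 hσ1
  refine ⟨σ, le_subnormalizer_of_isPGroup hP hxP hσP, ?_⟩
  have e1 := h2 u
  have e2 := h2 (x u)
  rw [p0 u hu] at e1
  rw [p0 _ ((hX u).mpr hu), hcx] at e2
  -- `u` and `x u` agree in `p` and differ in `c`, so an element with `l = 1` separates them.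
  have e3 : p (σ (x u)) = p (σ u) + 1 := by rw [e1, e2]; ring
  by_cases h : σ u ∈ X
  · refine Or.inl ⟨h, fun h' => ?_⟩
    rw [p0 _ h, p0 _ h'] at e3
    exact absurd e3 (by decide)
  · refine Or.inr ⟨h, by_contra fun h' => ?_⟩
    rw [p1 _ h, p1 _ h'] at e3
    exact absurd e3 (by decide)

theorem subtypePerm_pow_eq_one {p : α → Prop} {x : Equiv.Perm α} (hp : ∀ a, p (x a) ↔ p a) {n : ℕ}
    (h : ∀ a, p a → (x ^ n) a = a) : x.subtypePerm hp ^ n = 1 := by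
  rw [Equiv.Perm.subtypePerm_pow]
  ext a
  exact h a a.2

theorem subnormalizer_one {G : Type*} [Group G] [Finite G] : subnormalizer (1 : G) = ⊤ :=
  eq_top_iff.mpr fun g _ => NormalizesTwoGroup.mem_subnormalizer
    ⟨⊥, IsPGroup.of_bot, one_mem _, by rw [normalizer_eq_top]; trivial⟩

/-- A `2`-element with a cycle filling half of the points and without fixed points has full
subnormalizer, provided that this is known for its restrictions to half of the points. -/
theorem subnormalizer_eq_top_of_long_cycle [Finite α] {k : ℕ} {x : Equiv.Perm α}
    (hcard : Nat.card α = 2 ^ (k + 2)) (hx1 : x ^ 2 ^ (k + 1) = 1) (hfix : ∀ a, x a ≠ a)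
    (ih : ∀ {X : Set α} (hX : ∀ a, x a ∈ X ↔ a ∈ X), X.ncard = 2 ^ (k + 1) →
      (∀ a ∈ X, (x ^ 2 ^ k) a = a) → subnormalizer (x.subtypePerm hX) = ⊤)
    {d : α} (hd : (x ^ 2 ^ k) d ≠ d) : subnormalizer x = ⊤ := by
  classical
  have hx := isPGroup_zpowers_of_pow_eq_one hx1
  have hper : ∀ a, (x ^ 2 ^ k) a ≠ a → Function.minimalPeriod x a = 2 ^ (k + 1) := fun a ha =>
    minimalPeriod_eq_two_pow ha (by rw [hx1]; rfl)
  have hinv : ∀ a, x a ∈ {b | x.SameCycle d b} ↔ a ∈ {b | x.SameCycle d b} :=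
    fun b => Equiv.Perm.sameCycle_apply_right
  have hinv' : ∀ a, x a ∈ {b | x.SameCycle d b}ᶜ ↔ a ∈ {b | x.SameCycle d b}ᶜ :=
    fun b => not_congr (hinv b)
  have hD : {b | x.SameCycle d b}.ncard = 2 ^ (k + 1) := by rw [ncard_sameCycle, hper d hd]
  have hO : {b | x.SameCycle d b}ᶜ.ncard = 2 ^ (k + 1) := by
    have := Set.ncard_add_ncard_compl {b | x.SameCycle d b}
    rw [hD, hcard, pow_succ 2 (k + 1)] at this
    lia
  have hxK := self_mem_subnormalizer x
  by_cases hex : ∃ b, ¬ x.SameCycle d b ∧ (x ^ 2 ^ k) b ≠ b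
  · obtain ⟨b, hb, hb1⟩ := hex
    have hO' : {a | x.SameCycle b a} = {a | x.SameCycle d a}ᶜ := by
      refine Set.eq_of_subset_of_ncard_le (fun a ha h => hb (Equiv.Perm.SameCycle.trans h ha.symm))
        ?_
      rw [hO, ncard_sameCycle, hper b hb1]
    have hswap : ∀ a c, x.SameCycle d a → ¬ x.SameCycle d c → Equiv.swap a c ∈ subnormalizer x := by
      intro a c ha hc
      have hc' : x.SameCycle b c := by
        have : c ∈ {a | x.SameCycle d a}ᶜ := hc
        rwa [← hO'] at this
      refine swap_mem_subnormalizer_of_period_eq hx (fun i => ?_) (fun h => hc (ha.trans h))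
      have hpa : Function.minimalPeriod x a = 2 ^ (k + 1) := by
        rw [← ncard_sameCycle, ← hD]
        congr 1
        ext e
        exact ⟨fun h => ha.trans h, fun h => ha.symm.trans h⟩
      have hpc : Function.minimalPeriod x c = 2 ^ (k + 1) := by
        rw [← ncard_sameCycle, ← hper b hb1, ← ncard_sameCycle]
        congr 1
        ext e
        exact ⟨fun h => hc'.trans h, fun h => hc'.symm.trans h⟩
      rw [zpow_apply_eq_self_iff, zpow_apply_eq_self_iff, hpa, hpc]
    refine eq_top_of_forall_swap_mem d fun c => ?_
    by_cases hc : x.SameCycle d c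
    · exact swap_mem_trans (hswap d b (.refl x d) hb) (Equiv.swap_comm c b ▸ hswap c b hc hb)
    · exact hswap d c (.refl x d) hc
  -- Induction gives all transpositions off the long cycle. The splitting element carries `(u x u)`
  -- to a transposition linking the two halves, and powers of `x` move its end `w` around the long
  -- cycle.
  · push Not at hex
    have htop := ih hinv' hO hex
    have hsw : ∀ a b, ¬ x.SameCycle d a → ¬ x.SameCycle d b →
        Equiv.swap a b ∈ subnormalizer x := fun a b ha hb =>
      swap_mem_of_subnormalizer_subtypePerm_eq_top hinv' hx htop ha hb
    obtain ⟨u, hu⟩ : {b | x.SameCycle d b}ᶜ.Nonempty := (Set.ncard_pos).mp (by rw [hO]; positivity)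
    have huv : ∃ v w, ¬ x.SameCycle d v ∧ x.SameCycle d w ∧
        Equiv.swap v w ∈ subnormalizer x := by
      obtain ⟨σ, hσ, h | h⟩ := exists_mem_subnormalizer_splitting hx hfix hinv'
        (by rw [compl_compl, hO, hD]) hu
      · exact ⟨σ u, σ (x u), h.1, not_not.mp h.2,
          swap_conj_mem hσ (hsw _ _ hu ((hinv' u).mpr hu))⟩
      · exact ⟨σ (x u), σ u, h.2, not_not.mp h.1,
          swap_conj_mem hσ (hsw _ _ ((hinv' u).mpr hu) hu)⟩
    obtain ⟨v, w, hv, hw, hvw⟩ := huv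
    refine eq_top_of_forall_swap_mem u fun c => ?_
    by_cases hc : x.SameCycle d c
    · obtain ⟨i, rfl⟩ := hw.symm.trans hc
      exact swap_mem_trans (hsw u _ hu ((apply_zpow_mem_iff hinv' i v).mpr hv))
        (swap_conj_mem (zpow_mem hxK i) hvw)
    · exact hsw u c hu hc

/-- If all cycles of `x` are shorter than half the number of points, some two disjoint invariant
sets of a quarter of the points carry only cycles of less than this size, or no fixed points. -/
theorem exists_invariant_quarters [Finite α] {k : ℕ} {x : Equiv.Perm α}
    (hcard : Nat.card α = 2 ^ (k + 3)) (hx1 : x ^ 2 ^ (k + 1) = 1) :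
    ∃ X Y : Set α, (∀ a, x a ∈ X ↔ a ∈ X) ∧ (∀ a, x a ∈ Y ↔ a ∈ Y) ∧ Disjoint X Y ∧
      X.ncard = 2 ^ (k + 1) ∧ Y.ncard = 2 ^ (k + 1) ∧
      ((∀ a ∈ X ∪ Y, (x ^ 2 ^ k) a = a) ∨ ∀ a ∈ X ∪ Y, x a ≠ a) := by
  have h1 : ∀ a, (x ^ 2 ^ (k + 1)) a = a := fun a => by rw [hx1]; rfl
  have hcyc : ∀ d, (x ^ 2 ^ k) d ≠ d → {b | x.SameCycle d b}.ncard = 2 ^ (k + 1) := fun d hd => by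
    rw [ncard_sameCycle, minimalPeriod_eq_two_pow hd (h1 d)]
  have hfixc : ∀ d, (x ^ 2 ^ k) d ≠ d → ∀ b, x.SameCycle d b → x b ≠ b := by
    intro d hd b hb h
    rw [← hb.apply_eq_self_iff] at h
    refine hd ?_
    exact Equiv.Perm.pow_apply_eq_self_of_apply_eq_self h _
  have hpos : (0 : ℕ) < 2 ^ (k + 1) := by positivity
  have hpow : 2 ^ (k + 3) = 4 * 2 ^ (k + 1) := by ring
  have hsplit : ∀ W : Set α, (∀ a, x a ∈ W ↔ a ∈ W) → 2 * 2 ^ (k + 1) ≤ W.ncard →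
      (∀ a ∈ W, (x ^ 2 ^ k) a = a) →
      ∃ X Y : Set α, (∀ a, x a ∈ X ↔ a ∈ X) ∧ (∀ a, x a ∈ Y ↔ a ∈ Y) ∧ Disjoint X Y ∧
      X.ncard = 2 ^ (k + 1) ∧ Y.ncard = 2 ^ (k + 1) ∧
      ((∀ a ∈ X ∪ Y, (x ^ 2 ^ k) a = a) ∨ ∀ a ∈ X ∪ Y, x a ≠ a) := by
    intro W hW hWc hW1
    obtain ⟨X, hXW, hX, hXc⟩ := exists_invariant_subset (k + 1) hW (fun a _ => h1 a) (by lia)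
    obtain ⟨Y, hYW, hY, hYc⟩ := exists_invariant_subset (k + 1) (X := W \ X)
      (fun a => by simp only [Set.mem_sdiff, hX, hW]) (fun a _ => h1 a)
      (by rw [Set.ncard_sdiff hXW]; lia)
    refine ⟨X, Y, hX, hY, Set.disjoint_left.mpr fun a ha hb => (hYW hb).2 ha, hXc, hYc, Or.inl ?_⟩
    rintro a (ha | ha)
    exacts [hW1 a (hXW ha), hW1 a (hYW ha).1]
  by_cases hex : ∃ d, (x ^ 2 ^ k) d ≠ d
  · obtain ⟨d, hd⟩ := hex
    have hinv : ∀ a, x a ∈ {b | x.SameCycle d b} ↔ a ∈ {b | x.SameCycle d b} :=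
      fun b => Equiv.Perm.sameCycle_apply_right
    -- Two cycles of quarter size serve as `X` and `Y`, free of fixed points. If there is at most
    -- one, the points off it still number at least half and lie in shorter cycles.
    by_cases hex2 : ∃ e, ¬ x.SameCycle d e ∧ (x ^ 2 ^ k) e ≠ e
    · obtain ⟨e, hde, he⟩ := hex2
      refine ⟨{b | x.SameCycle d b}, {b | x.SameCycle e b}, hinv,
        fun b => Equiv.Perm.sameCycle_apply_right, ?_, hcyc d hd, hcyc e he, Or.inr ?_⟩
      · exact Set.disjoint_left.mpr fun a ha hb => hde (Equiv.Perm.SameCycle.trans ha hb.symm)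
      · rintro a (ha | ha)
        exacts [hfixc d hd a ha, hfixc e he a ha]
    · push Not at hex2
      refine hsplit {b | x.SameCycle d b}ᶜ (fun b => not_congr (hinv b)) ?_ hex2
      have := Set.ncard_add_ncard_compl {b | x.SameCycle d b}
      rw [hcyc d hd, hcard] at this
      lia
  · push Not at hex
    exact hsplit Set.univ (fun a => by simp) (by rw [Set.ncard_univ, hcard]; lia) fun a _ => hex a

/-- Induction gives all transpositions on the half `X ∪ Y`. The rest splits into two invariant
quarters `W`; an element of `Sub(x)` fixing `X` setwise and carrying `Y` to `W` turns transpositions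
between `X` and `Y` into ones between `X` and `W`. -/
theorem subnormalizer_eq_top_of_short_cycles [Finite α] {k : ℕ} {x : Equiv.Perm α}
    (hcard : Nat.card α = 2 ^ (k + 3)) (hx1 : x ^ 2 ^ (k + 1) = 1)
    (ih : ∀ {X : Set α} (hX : ∀ a, x a ∈ X ↔ a ∈ X), X.ncard = 2 ^ (k + 2) →
      ((∀ a ∈ X, (x ^ 2 ^ k) a = a) ∨ ∀ a ∈ X, x a ≠ a) →
      subnormalizer (x.subtypePerm hX) = ⊤) : subnormalizer x = ⊤ := by
  classical
  have hx := isPGroup_zpowers_of_pow_eq_one hx1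
  obtain ⟨X, Y, hX, hY, hXY, hXc, hYc, hor⟩ := exists_invariant_quarters hcard hx1
  have hU : ∀ a, x a ∈ X ∪ Y ↔ a ∈ X ∪ Y := fun a => by simp only [Set.mem_union, hX, hY]
  have hUc : (X ∪ Y).ncard = 2 ^ (k + 2) := by
    rw [Set.ncard_union_eq hXY, hXc, hYc]; ring
  have hpos : (0 : ℕ) < 2 ^ (k + 1) := by positivity
  have hpow : 2 ^ (k + 3) = 4 * 2 ^ (k + 1) := by ring
  have hpow2 : 2 ^ (k + 2) = 2 * 2 ^ (k + 1) := by ring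
  have hsw : ∀ a b, a ∈ X ∪ Y → b ∈ X ∪ Y → Equiv.swap a b ∈ subnormalizer x := fun a b ha hb =>
    swap_mem_of_subnormalizer_subtypePerm_eq_top hU hx (ih hU hUc hor) ha hb
  obtain ⟨u, hu⟩ : X.Nonempty := (Set.ncard_pos).mp (by rw [hXc]; exact hpos)
  obtain ⟨Z, hZW, hZ, hZc⟩ := exists_invariant_subset (x := x) (k + 1) (X := (X ∪ Y)ᶜ)
    (fun a => not_congr (hU a)) (fun a _ => by rw [hx1]; rfl) (by
      have := Set.ncard_add_ncard_compl (X ∪ Y)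
      rw [hUc, hcard] at this
      lia)
  have hreach : ∀ W : Set α, (∀ a, x a ∈ W ↔ a ∈ W) → W ⊆ (X ∪ Y)ᶜ → W.ncard = 2 ^ (k + 1) →
      ∀ b ∈ W, Equiv.swap u b ∈ subnormalizer x := by
    intro W hW hWU hWc b hb
    obtain ⟨σ, hσ, hσX, hσY⟩ := exists_mem_subnormalizer_smul_eq hx
      (smul_set_eq_self_of_invariant hX) (smul_set_eq_self_of_invariant hY)
      (smul_set_eq_self_of_invariant hW) hXY
      (Set.disjoint_left.mpr fun a ha hb => hWU hb (Or.inl ha))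
      (Set.disjoint_left.mpr fun a ha hb => hWU hb (Or.inr ha))
      ((Set.ncard_pos).mp (by rw [hYc]; exact hpos)) (hYc.trans hWc.symm)
    rw [← hσY] at hb
    obtain ⟨c, hc, rfl⟩ := hb
    have hσu : σ u ∈ X := by
      rw [← hσX]; exact ⟨u, hu, rfl⟩
    exact swap_mem_trans (hsw u _ (Or.inl hu) (Or.inl hσu))
      (swap_conj_mem hσ (hsw u c (Or.inl hu) (Or.inr hc)))
  refine eq_top_of_forall_swap_mem u fun b => ?_
  by_cases hb : b ∈ X ∪ Y
  · exact hsw u b (Or.inl hu) hb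
  by_cases hbZ : b ∈ Z
  · exact hreach Z hZ hZW hZc b hbZ
  · refine hreach ((X ∪ Y)ᶜ \ Z) (fun a => ?_) Set.sdiff_subset ?_ b ⟨hb, hbZ⟩
    · simp only [Set.mem_sdiff, Set.mem_compl_iff, hU, hZ]
    · have := Set.ncard_add_ncard_compl (X ∪ Y)
      rw [hUc, hcard] at this
      rw [Set.ncard_sdiff hZW, hZc]
      lia

/-- The subnormalizer of a `2`-element of the symmetric group on `2 ^ (k + 1)` points is the whole
group if all cycles have length at most `2 ^ k` and, in case of a cycle of length `2 ^ k`, there is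
no fixed point. -/
theorem subnormalizer_eq_top.{u} (k : ℕ) : ∀ {α : Type u} [Finite α] {x : Equiv.Perm α},
    Nat.card α = 2 ^ (k + 1) → x ^ 2 ^ k = 1 → (x ^ 2 ^ (k - 1) = 1 ∨ ∀ a, x a ≠ a) →
    subnormalizer x = ⊤ := by
  induction k with
  | zero =>
    intro α _ x _ hx _
    rw [show x = 1 by simpa using hx]
    exact subnormalizer_one
  | succ k ih =>
    intro α _ x hcard hx hor
    by_cases hk : x ^ 2 ^ k = 1
    · cases k with
      | zero =>
        rw [show x = 1 by simpa using hk]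
        exact subnormalizer_one
      | succ k =>
        refine subnormalizer_eq_top_of_short_cycles hcard hk fun {X} hX hXc h => ?_
        refine ih (by rwa [Nat.card_coe_set_eq])
          (subtypePerm_pow_eq_one hX fun a _ => by rw [hk]; rfl) (h.imp (fun h => ?_) fun h => ?_)
        · exact subtypePerm_pow_eq_one hX h
        · exact fun a ha => h a a.2 (congrArg Subtype.val ha)
    · have hfix : ∀ a, x a ≠ a := hor.resolve_left hk
      obtain ⟨d, hd⟩ : ∃ d, (x ^ 2 ^ k) d ≠ d := by
        by_contra! h
        exact hk (Equiv.ext h)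
      refine subnormalizer_eq_top_of_long_cycle hcard hx hfix (fun {X} hX hXc h => ?_) hd
      exact ih (by rwa [Nat.card_coe_set_eq]) (subtypePerm_pow_eq_one hX h)
        (Or.inr fun a ha => hfix a (congrArg Subtype.val ha))

end FullSubnormalizer

/-! ### The representation of `Sym(Ω) ≀ S₂` on two halves -/

section HalfCycle

open RegularWreathProduct
open scoped Pointwise

/-- Among disjoint cycles only `x.cycleOf a` can move `a`, and `x a` stays in that cycle. -/
theorem noncommProd_apply_of_subset_cycleFactorsFinset {α : Type*} [Fintype α] [DecidableEq α]
    {x : Equiv.Perm α} (s : Finset (Equiv.Perm α)) (hs : s ⊆ x.cycleFactorsFinset)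
    (hc : (s : Set (Equiv.Perm α)).Pairwise (Function.onFun Commute id)) (a : α) :
    s.noncommProd id hc a = if x.cycleOf a ∈ s then x a else a := by
  induction s using Finset.induction_on generalizing a with
  | empty => rw [Finset.noncommProd_empty]; simp
  | insert c s hcs ih =>
    have hcx : c ∈ x.cycleFactorsFinset := hs (Finset.mem_insert_self c s)
    have hs' : s ⊆ x.cycleFactorsFinset := fun d hd => hs (Finset.mem_insert_of_mem hd)
    rw [Finset.noncommProd_insert_of_notMem _ _ _ _ hcs, Equiv.Perm.mul_apply, ih hs']
    have hc_apply : ∀ b, c b = if x.cycleOf b = c then x b else b := by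
      intro b
      by_cases hb : b ∈ c.support
      · rw [if_pos (Equiv.Perm.cycle_is_cycleOf hb hcx).symm]
        exact ((Equiv.Perm.mem_cycleFactorsFinset_iff.mp hcx).2 b hb)
      · rw [Equiv.Perm.notMem_support.mp hb, if_neg]
        rintro rfl
        apply hb
        rw [Equiv.Perm.mem_support_cycleOf_iff]
        exact ⟨.refl x b, Equiv.Perm.cycleOf_mem_cycleFactorsFinset_iff.mp hcx⟩
    simp only [id, Finset.mem_insert]
    by_cases h1 : x.cycleOf a ∈ s
    · have h2 : x.cycleOf a ≠ c := fun h => hcs (h ▸ h1)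
      rw [if_pos h1, if_pos (Or.inr h1), hc_apply, if_neg]
      rwa [(Equiv.Perm.sameCycle_apply_left.mpr (.refl x a)).cycleOf_eq]
    · rw [if_neg h1, hc_apply]
      simp [h1]

theorem shortCycleProduct_apply {α : Type*} [Fintype α] [DecidableEq α] (x : Equiv.Perm α) (m : ℕ)
    {a : α} (ha : a ∈ shortCyclePoints x m) : shortCycleProduct x m a = x a := by
  refine (noncommProd_apply_of_subset_cycleFactorsFinset _ (Finset.filter_subset _ _) _ a).trans ?_
  by_cases hxa : x a = a
  · simp [hxa]
  · rw [if_pos]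
    rw [Finset.mem_filter, Equiv.Perm.cycleOf_mem_cycleFactorsFinset_iff, Equiv.Perm.mem_support]
    refine ⟨hxa, ?_⟩
    have : ((x.cycleOf a).support : Set α) = {b | x.SameCycle a b} := by
      ext b
      rw [Finset.mem_coe, Equiv.Perm.mem_support_cycleOf_iff, Equiv.Perm.mem_support]
      exact ⟨fun h => h.1, fun h => ⟨h, hxa⟩⟩
    rw [← Set.ncard_coe_finset, this, ncard_sameCycle]
    exact ha

variable {α : Type*}

/-- The representation of `Sym(Ω) ≀ S₂` on `α`, identified with two copies of `Ω`. -/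
def wreathRep {Ω : Type*} (f : Ω × Equiv.Perm (Fin 2) ≃ α) :
    Equiv.Perm Ω ≀ᵣ Equiv.Perm (Fin 2) →* Equiv.Perm α :=
  f.permCongrHom.toMonoidHom.comp (toPerm (Equiv.Perm Ω) (Equiv.Perm (Fin 2)) Ω)

theorem wreathRep_injective {Ω : Type*} [Nonempty Ω] (f : Ω × Equiv.Perm (Fin 2) ≃ α) :
    Function.Injective (wreathRep f) :=
  f.permCongrHom.injective.comp (toPermInj (Equiv.Perm Ω) (Equiv.Perm (Fin 2)) Ω)

theorem wreathRep_apply {Ω : Type*} (f : Ω × Equiv.Perm (Fin 2) ≃ α)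
    (w : Equiv.Perm Ω ≀ᵣ Equiv.Perm (Fin 2)) (a : Ω) (r : Equiv.Perm (Fin 2)) :
    wreathRep f w (f (a, r)) = f (w.left (w.right * r) a, w.right * r) := by
  change f (w • f.symm (f (a, r))) = _
  rw [Equiv.symm_apply_apply]
  rfl

theorem exists_wreathRep_eq {Ω : Type*} [Finite Ω] (f : Ω × Equiv.Perm (Fin 2) ≃ α)
    {g : Equiv.Perm α} {q : Equiv.Perm (Fin 2)} (h : ∀ a r, (f.symm (g (f (a, r)))).2 = q * r) :
    ∃ w, wreathRep f w = g ∧ w.right = q := by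
  have hinj : ∀ r, Function.Injective fun a : Ω => (f.symm (g (f (a, q⁻¹ * r)))).1 := by
    intro r a b hab
    have h1 : f.symm (g (f (a, q⁻¹ * r))) = f.symm (g (f (b, q⁻¹ * r))) :=
      Prod.ext hab (by rw [h, h])
    simpa using h1
  refine ⟨⟨fun r => Equiv.ofBijective _ (Finite.injective_iff_bijective.mp (hinj r)), q⟩,
    Equiv.ext fun b => ?_, rfl⟩
  obtain ⟨⟨a, r⟩, rfl⟩ := f.surjective b
  rw [wreathRep_apply]
  simp only [Equiv.ofBijective_apply, inv_mul_cancel_left]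
  rw [← Equiv.eq_symm_apply]
  exact Prod.ext rfl (h a r).symm

/-- `y` lies in some Sylow 2-subgroup, and `Sub(z)` is one, so the two are conjugate. -/
theorem exists_mem_subnormalizer_conj {A : Type*} [Group A] [Finite A] {y z : A}
    (hy : IsPGroup 2 (zpowers y)) (hz : IsPGroup 2 (subnormalizer z)) :
    ∃ c, y ∈ subnormalizer (c * z * c⁻¹) := by
  obtain ⟨P, hP⟩ := hy.exists_le_sylow
  obtain ⟨c, hc⟩ := MulAction.exists_smul_eq A (sylowSubnormalizer hz) P
  refine ⟨c, le_subnormalizer_of_isPGroup P.2 ?_ (hP (mem_zpowers y))⟩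
  rw [← hc]
  exact ⟨z, self_mem_subnormalizer z, rfl⟩

theorem IsFullCycle.conj {z : Equiv.Perm α} (hz : IsFullCycle z) (c : Equiv.Perm α) :
    IsFullCycle (c * z * c⁻¹) := by
  intro a b
  obtain ⟨i, hi⟩ := hz (c⁻¹ a) (c⁻¹ b)
  refine ⟨i, ?_⟩
  rw [conj_zpow, Equiv.Perm.mul_apply, Equiv.Perm.mul_apply, hi]
  simp

/-- The identification of `α` with two copies of `Ω` given by `e : Ω ≃ Ωᶜ`. -/
noncomputable def doubleEquiv {Ω : Set α} (e : Ω ≃ (Ωᶜ : Set α)) :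
    Ω × Equiv.Perm (Fin 2) ≃ α :=
  Equiv.ofBijective (fun p => if p.2 = 1 then (p.1 : α) else e p.1) (by
    classical
    constructor
    · rintro ⟨a, r⟩ ⟨b, s⟩ hab
      rcases perm_fin_two_eq_or r with rfl | rfl <;> rcases perm_fin_two_eq_or s with rfl | rfl
      · simpa [Subtype.ext_iff] using hab
      · have hab' : (a : α) = e b := by simpa using hab
        exact absurd a.2 (hab' ▸ (e b).2)
      · have hab' : (e a : α) = b := by simpa using hab
        exact absurd b.2 (hab' ▸ (e a).2)
      · simpa [← Subtype.ext_iff] using hab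
    · intro b
      by_cases hb : b ∈ Ω
      · exact ⟨(⟨b, hb⟩, 1), by simp⟩
      · exact ⟨(e.symm ⟨b, hb⟩, Equiv.swap 0 1), by simp⟩)

theorem doubleEquiv_one {Ω : Set α} (e : Ω ≃ (Ωᶜ : Set α)) (a : Ω) :
    doubleEquiv e (a, 1) = a := by
  change (if (1 : Equiv.Perm (Fin 2)) = 1 then (a : α) else e a) = a
  exact if_pos rfl

theorem doubleEquiv_swap {Ω : Set α} (e : Ω ≃ (Ωᶜ : Set α)) (a : Ω) :
    doubleEquiv e (a, Equiv.swap 0 1) = e a := by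
  change (if (Equiv.swap 0 1 : Equiv.Perm (Fin 2)) = 1 then (a : α) else e a) = e a
  exact if_neg perm_fin_two_ne

theorem doubleEquiv_symm_snd_eq_one_iff {Ω : Set α} (e : Ω ≃ (Ωᶜ : Set α)) (b : α) :
    ((doubleEquiv e).symm b).2 = 1 ↔ b ∈ Ω := by
  obtain ⟨⟨a, r⟩, rfl⟩ := (doubleEquiv e).surjective b
  rw [Equiv.symm_apply_apply]
  rcases perm_fin_two_eq_or r with rfl | rfl
  · simp [doubleEquiv_one]
  · rw [doubleEquiv_swap]
    exact iff_of_false perm_fin_two_ne (e a).2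

/-- Permutations that preserve `Ω` or exchange it with its complement lie in `Sym(Ω) ≀ S₂`. -/
theorem exists_wreathRep_doubleEquiv_eq [Finite α] {Ω : Set α} (e : Ω ≃ (Ωᶜ : Set α))
    {g : Equiv.Perm α} (h : (∀ a, g a ∈ Ω ↔ a ∈ Ω) ∨ ∀ a, g a ∈ Ω ↔ a ∉ Ω) :
    ∃ w, wreathRep (doubleEquiv e) w = g ∧ ((∀ a, g a ∈ Ω ↔ a ∈ Ω) → w.right = 1) := by
  have heq : ∀ q r : Equiv.Perm (Fin 2), (q = 1 ↔ r = 1) → q = r := by decide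
  have hne : ∀ q r : Equiv.Perm (Fin 2), (q = 1 ↔ ¬ r = 1) → q = Equiv.swap 0 1 * r := by decide
  by_cases h1 : ∀ a, g a ∈ Ω ↔ a ∈ Ω
  · obtain ⟨w, hw, hw1⟩ := exists_wreathRep_eq (doubleEquiv e) (g := g) (q := 1) (fun a r => by
      rw [one_mul]
      refine heq _ _ ?_
      rw [doubleEquiv_symm_snd_eq_one_iff, h1, ← doubleEquiv_symm_snd_eq_one_iff e,
        Equiv.symm_apply_apply])
    exact ⟨w, hw, fun _ => hw1⟩
  · obtain ⟨w, hw, -⟩ := exists_wreathRep_eq (doubleEquiv e) (g := g) (q := Equiv.swap 0 1)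
      (fun a r => by
        refine hne _ _ ?_
        rw [doubleEquiv_symm_snd_eq_one_iff, h.resolve_left h1,
          ← doubleEquiv_symm_snd_eq_one_iff e, Equiv.symm_apply_apply])
    exact ⟨w, hw, fun h => absurd h h1⟩

end HalfCycle

/-! ### A half-length cycle together with a fixed point -/

section HalfCycleSubnormalizer

open RegularWreathProduct
open scoped Pointwise

variable {α : Type*}

theorem minimalPeriod_eq_of_sameCycle {x : Equiv.Perm α} {a b : α} (h : x.SameCycle a b) :
    Function.minimalPeriod x a = Function.minimalPeriod x b := by
  rw [← ncard_sameCycle, ← ncard_sameCycle]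
  congr 1
  ext c
  exact ⟨fun h' => h.symm.trans h', fun h' => h.trans h'⟩

theorem not_sameCycle_of_apply_eq_self {x : Equiv.Perm α} {a d : α} (ha : x a = a) (hd : d ≠ a) :
    ¬ x.SameCycle d a := by
  rintro ⟨i, hi⟩
  have h : (x ^ i) a = a := Equiv.Perm.zpow_apply_eq_self_of_apply_eq_self ha i
  exact hd ((x ^ i).injective (hi.trans h.symm))

/-- If one cycle of `x` fills half of the points and `x` has a fixed point, then that cycle is the
complement of the set of points in shorter cycles. -/
theorem shortCyclePoints_eq_compl [Finite α] {n : ℕ} {x : Equiv.Perm α}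
    (hcard : Nat.card α = 2 ^ (n + 2)) {a d : α} (ha : x a = a)
    (hd : Function.minimalPeriod x d = 2 ^ (n + 1)) :
    shortCyclePoints x (2 ^ (n + 1)) = {b | x.SameCycle d b}ᶜ := by
  have hpa : Function.minimalPeriod x a = 1 := Function.minimalPeriod_eq_one_iff_isFixedPt.mpr ha
  have h1 : (1 : ℕ) < 2 ^ (n + 1) := Nat.one_lt_two_pow (by lia)
  have hne : ∀ b, Function.minimalPeriod x b = 2 ^ (n + 1) → ¬ x.SameCycle b a := fun b hb =>
    not_sameCycle_of_apply_eq_self ha (by rintro rfl; lia)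
  have hO : {b | x.SameCycle d b}ᶜ.ncard = 2 ^ (n + 1) := by
    have := Set.ncard_add_ncard_compl {b | x.SameCycle d b}
    rw [ncard_sameCycle, hd, hcard, pow_succ 2 (n + 1)] at this
    lia
  ext b
  constructor
  · intro hb hdb
    have hb' : Function.minimalPeriod x b < 2 ^ (n + 1) := hb
    rw [← minimalPeriod_eq_of_sameCycle hdb, hd] at hb'
    exact lt_irrefl _ hb'
  · intro hb
    have hsub : {c | x.SameCycle b c} ⊆ {c | x.SameCycle d c}ᶜ :=
      fun c hc h => hb (Equiv.Perm.SameCycle.trans h hc.symm)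
    have hle := Set.ncard_le_ncard hsub
    rw [hO, ncard_sameCycle] at hle
    -- A second cycle of half length would fill the complement and so contain the fixed point `a`.
    refine lt_of_le_of_ne hle fun heq => hne b heq ?_
    have := Set.eq_of_subset_of_ncard_le hsub (by rw [hO, ncard_sameCycle, heq])
    change a ∈ {c | x.SameCycle b c}
    rw [this]
    exact hne d hd

/-- An invariant set contains the whole cycle of `d` or misses it; the sizes then force equality. -/
theorem eq_or_eq_compl_of_invariant [Finite α] {x : Equiv.Perm α} {d : α}
    (hc : {b | x.SameCycle d b}.ncard = {b | x.SameCycle d b}ᶜ.ncard) {X : Set α} (hX : x • X = X)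
    (hXc : X.ncard = {b | x.SameCycle d b}.ncard) :
    X = {b | x.SameCycle d b} ∨ X = {b | x.SameCycle d b}ᶜ := by
  have hinv : ∀ a, x a ∈ X ↔ a ∈ X := fun a => by
    conv_lhs => rw [← hX]
    exact Set.smul_mem_smul_set_iff
  by_cases hd : d ∈ X
  · left
    refine (Set.eq_of_subset_of_ncard_le ?_ hXc.le).symm
    rintro _ ⟨i, rfl⟩
    exact (apply_zpow_mem_iff hinv i d).mpr hd
  · right
    refine Set.eq_of_subset_of_ncard_le ?_ (hc.symm.trans hXc.symm).le
    rintro _ hb ⟨i, rfl⟩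
    exact hd ((apply_zpow_mem_iff hinv i d).mp hb)

/-- If `x` has a fixed point and a cycle `Δ` filling half of the points, then elements normalizing
a `2`-group that contains `x` preserve the partition into `Δ` and its complement. -/
theorem NormalizesTwoGroup.smul_cycle_eq [Finite α] {x g : Equiv.Perm α} {a d : α} (ha : x a = a)
    (hc : {b | x.SameCycle d b}.ncard = {b | x.SameCycle d b}ᶜ.ncard)
    (hg : NormalizesTwoGroup x g) : g • {b | x.SameCycle d b} = {b | x.SameCycle d b} ∨
      g • {b | x.SameCycle d b} = {b | x.SameCycle d b}ᶜ := by
  set D := {b | x.SameCycle d b} with hDdef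
  have hE : ∀ g : Equiv.Perm α, g ∈ MulAction.stabilizer (Equiv.Perm α) ({D, Dᶜ} : Set (Set α)) ↔
      g • D = D ∨ g • D = Dᶜ := by
    intro g
    rw [MulAction.mem_stabilizer_iff, Set.smul_set_insert, Set.smul_set_singleton,
      Set.pair_eq_pair_iff, Set.smul_set_compl]
    constructor
    · rintro (h | h)
      exacts [Or.inl h.1, Or.inr h.1]
    · rintro (h | h)
      · exact Or.inl ⟨h, by rw [h]⟩
      · exact Or.inr ⟨h, by rw [h, compl_compl]⟩
  have hxD : x • D = D := smul_set_eq_self_of_invariant fun b => Equiv.Perm.sameCycle_apply_right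
  rw [← hE]
  refine hg.mem_of_normalizer_le ((hE x).mpr (Or.inl hxD)) fun M hM hxM n hn => ?_
  have h1 : n⁻¹ * x * n ∈ M := (mem_normalizer_iff''.mp hn x).mp hxM
  -- This conjugate of `x` fixes `n⁻¹ a`, so it cannot exchange `D` with its complement. Hence `x`
  -- stabilizes `n • D`.
  have h2 : (n⁻¹ * x * n) • D = D := by
    refine ((hE _).mp (hM h1)).resolve_right fun h => ?_
    have hq : (n⁻¹ * x * n) • (n⁻¹ • a) = n⁻¹ • a := by
      rw [smul_smul, mul_assoc, mul_inv_cancel, mul_one, mul_smul]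
      exact congrArg _ ha
    have h3 : n⁻¹ • a ∈ (n⁻¹ * x * n) • D ↔ n⁻¹ • a ∈ D := by
      conv_lhs => rw [← hq]
      exact Set.smul_mem_smul_set_iff
    rw [h, Set.mem_compl_iff] at h3
    tauto
  rw [hE]
  refine eq_or_eq_compl_of_invariant hc ?_ (Set.ncard_image_of_injective D n.injective)
  rw [mul_assoc, mul_smul, inv_smul_eq_iff, mul_smul] at h2
  exact h2

theorem apply_mem_compl_iff_of_smul_eq {D : Set α} {g : Equiv.Perm α}
    (h : g • D = D ∨ g • D = Dᶜ) :
    (∀ a, g a ∈ Dᶜ ↔ a ∈ Dᶜ) ∨ ∀ a, g a ∈ Dᶜ ↔ a ∉ Dᶜ := by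
  have h0 : ∀ a, g a ∈ g • D ↔ a ∈ D := fun a => Set.smul_mem_smul_set_iff (a := g)
  refine h.imp (fun h a => ?_) fun h a => ?_
  · have := h0 a
    rw [h] at this
    exact not_congr this
  · have := h0 a
    rw [h] at this
    rw [this, Set.notMem_compl_iff]

/-- The transposition of `d` and `a` breaks the partition: it moves `d` out of `D` and keeps `x d`
in `D`. -/
theorem subnormalizer_ne_top_of_half_cycle [Finite α] {x : Equiv.Perm α} {a d : α} (ha : x a = a)
    (hd : x d ≠ d) (hx : IsPGroup 2 (zpowers x))
    (hc : {b | x.SameCycle d b}.ncard = {b | x.SameCycle d b}ᶜ.ncard) :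
    subnormalizer x ≠ ⊤ := by
  classical
  intro htop
  set D := {b | x.SameCycle d b} with hDdef
  have had : ¬ x.SameCycle d a := not_sameCycle_of_apply_eq_self ha (by rintro rfl; exact hd ha)
  have hle : subnormalizer x ≤ MulAction.stabilizer (Equiv.Perm α) ({D, Dᶜ} : Set (Set α)) := by
    rw [subnormalizer_eq_closure hx, closure_le]
    intro g hg
    rw [SetLike.mem_coe, MulAction.mem_stabilizer_iff, Set.smul_set_insert, Set.smul_set_singleton,
      Set.smul_set_compl]
    rcases hg.smul_cycle_eq ha hc with h | h
    · rw [← hDdef] at h; rw [h]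
    · rw [← hDdef] at h; rw [h, compl_compl, Set.pair_comm]
  have hsw := hle (htop ▸ mem_top (Equiv.swap d a))
  rw [MulAction.mem_stabilizer_iff, Set.smul_set_insert, Set.smul_set_singleton,
    Set.pair_eq_pair_iff] at hsw
  have haD : a ∈ Equiv.swap d a • D := ⟨d, .refl x d, Equiv.swap_apply_left d a⟩
  have hxd : x.SameCycle d (x d) := Equiv.Perm.sameCycle_apply_right.mpr (.refl x d)
  have hxD : x d ∈ Equiv.swap d a • D :=
    ⟨x d, hxd, Equiv.swap_apply_of_ne_of_ne hd (fun h => had (h ▸ hxd))⟩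
  rcases hsw with h | h
  · rw [h.1] at haD; exact had haD
  · rw [h.1] at hxD; exact hxD hxd

/-- The subnormalizer of a `2`-element of `Sym(2 ^ (n + 2))` with a fixed point and a cycle of
length `2 ^ (n + 1)` is an imprimitive wreath product. -/
theorem subnormalizer_eq_wreathS2 [Finite α] {n : ℕ} {x : Equiv.Perm α}
    (hcard : Nat.card α = 2 ^ (n + 2)) (hx1 : x ^ 2 ^ (n + 1) = 1) {a d : α} (ha : x a = a)
    (hd : Function.minimalPeriod x d = 2 ^ (n + 1)) :
    ∃ (y : Equiv.Perm (shortCyclePoints x (2 ^ (n + 1))))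
      (f : shortCyclePoints x (2 ^ (n + 1)) × Equiv.Perm (Fin 2) ≃ α),
      (∀ a, (y a : α) = x a) ∧ (∀ a, f (a, 1) = a) ∧
      subnormalizer x = wreathS2 (subnormalizer y) f := by
  have hx := isPGroup_zpowers_of_pow_eq_one hx1
  rw [shortCyclePoints_eq_compl hcard ha hd]
  set D := {b | x.SameCycle d b} with hDdef
  have hDc : D.ncard = 2 ^ (n + 1) := by rw [ncard_sameCycle, hd]
  have hOc : Dᶜ.ncard = 2 ^ (n + 1) := by
    have := Set.ncard_add_ncard_compl D
    rw [hDc, hcard, pow_succ 2 (n + 1)] at this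
    lia
  have hinv : ∀ b, x b ∈ D ↔ b ∈ D := fun b => Equiv.Perm.sameCycle_apply_right
  have hinv' : ∀ b, x b ∈ Dᶜᶜ ↔ b ∈ Dᶜᶜ := fun b => by rw [compl_compl, hinv]
  have hinvc : ∀ b, x b ∈ Dᶜ ↔ b ∈ Dᶜ := fun b => not_congr (hinv b)
  have : Nonempty (Dᶜ : Set α) :=
    ((Set.ncard_pos).mp (by rw [hOc]; positivity)).to_subtype
  obtain ⟨e⟩ : Nonempty ((Dᶜ : Set α) ≃ (Dᶜᶜ : Set α)) := Finite.card_eq.mp (by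
    rw [Nat.card_coe_set_eq, Nat.card_coe_set_eq, compl_compl, hOc, hDc])
  -- `z` is the long cycle transported to `Ω = Dᶜ` by an arbitrary bijection `e`. Correcting `e` by
  -- `c` replaces `z` by a conjugate whose subnormalizer contains the short part `y`.
  set z : Equiv.Perm (Dᶜ : Set α) := e.symm.permCongr (x.subtypePerm hinv') with hzdef
  have hzpow : ∀ i : ℤ, z ^ i = e.symm.permCongr (x.subtypePerm hinv' ^ i) := fun i =>
    (map_zpow e.symm.permCongrHom (x.subtypePerm hinv') i).symm
  have hzfull : IsFullCycle z := by
    intro b c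
    have hb : x.SameCycle d (e b) := not_not.mp (e b).2
    have hc : x.SameCycle d (e c) := not_not.mp (e c).2
    obtain ⟨i, hi⟩ := hb.symm.trans hc
    refine ⟨i, ?_⟩
    rw [hzpow, Equiv.permCongr_apply, Equiv.symm_symm, Equiv.symm_apply_eq,
      Equiv.Perm.subtypePerm_zpow]
    exact Subtype.ext hi
  have hz1 : z ^ 2 ^ (n + 1) = 1 := by
    have h1 : x.subtypePerm hinv' ^ 2 ^ (n + 1) = 1 :=
      subtypePerm_pow_eq_one (p := (· ∈ Dᶜᶜ)) hinv' fun b _ => by rw [hx1]; rfl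
    have h2 := map_pow e.symm.permCongrHom (x.subtypePerm hinv') (2 ^ (n + 1))
    rw [h1, map_one] at h2
    exact h2.symm
  have hy2 : IsPGroup 2 (zpowers (x.subtypePerm hinvc)) :=
    isPGroup_zpowers_subtypePerm (p := (· ∈ Dᶜ)) hinvc hx
  obtain ⟨c, hc⟩ := exists_mem_subnormalizer_conj hy2 (hzfull.isPGroup_subnormalizer _ hz1)
  have hQ : IsPGroup 2 (subnormalizer (c * z * c⁻¹)) :=
    (hzfull.conj c).isPGroup_subnormalizer (n + 1) (by rw [conj_pow, hz1]; simp)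
  set e' : (Dᶜ : Set α) ≃ (Dᶜᶜ : Set α) := c.symm.trans e with he'
  obtain ⟨w, hw, hw1⟩ := exists_wreathRep_doubleEquiv_eq e' (g := x) (Or.inl hinvc)
  have hw1 := hw1 hinvc
  have hwapp : ∀ b r, doubleEquiv e' (w.left r b, r) = x (doubleEquiv e' (b, r)) := fun b r => by
    rw [← hw, wreathRep_apply, hw1, one_mul]
  have hleft1 : w.left 1 = x.subtypePerm hinvc := by
    ext b
    have := hwapp b 1
    rwa [doubleEquiv_one, doubleEquiv_one] at this
  have hlefts : w.left (Equiv.swap 0 1) = c * z * c⁻¹ := by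
    ext1 b
    have := hwapp b (Equiv.swap 0 1)
    rw [doubleEquiv_swap, doubleEquiv_swap] at this
    refine e'.injective (Subtype.ext (this.trans ?_))
    simp [he', hzdef, Equiv.permCongr_apply]
  refine ⟨x.subtypePerm hinvc, doubleEquiv e', fun b => rfl, doubleEquiv_one e', ?_⟩
  have hxw : IsPGroup 2 (zpowers (wreathRep (doubleEquiv e') w)) := by rwa [hw]
  have hinj := wreathRep_injective (doubleEquiv e')
  have hw2 : IsPGroup 2 (zpowers w) :=
    (hxw.comap_of_injective _ hinj).to_le (zpowers_le.mpr (mem_zpowers _))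
  have hsub := subnormalizer_map_of_injective hinj hxw (fun g hg => by
    rw [hw] at hg
    obtain ⟨v, hv, -⟩ := exists_wreathRep_doubleEquiv_eq e' (apply_mem_compl_iff_of_smul_eq
      (hg.smul_cycle_eq ha (hDc.trans hOc.symm)))
    exact ⟨v, hv⟩)
  rw [hw, subnormalizer_eq_wreathSubgroup hw1 (by rwa [hlefts]) (by rwa [hlefts, hleft1]) hw2,
    hleft1] at hsub
  rw [hsub, wreathS2_eq_map]
  rfl

end HalfCycleSubnormalizer

/-! ### Case distinction on the cycle type -/

section Main

variable {α : Type*}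

/-- Three divides the order `n!` once `n ≥ 3`. -/
theorem not_isPGroup_two_perm [Finite α] (h : 3 ≤ Nat.card α) :
    ¬ IsPGroup 2 (⊤ : Subgroup (Equiv.Perm α)) := by
  intro hp
  obtain ⟨m, hm⟩ := IsPGroup.iff_card.mp hp
  rw [Subgroup.card_top, Nat.card_perm] at hm
  have h3 : 3 ∣ 2 ^ m := hm ▸ Nat.dvd_factorial (by norm_num) h
  exact absurd (Nat.prime_three.dvd_of_dvd_pow h3) (by norm_num)

theorem isFullCycle_of_isCycle [Fintype α] [DecidableEq α] {x : Equiv.Perm α} (hx : x.IsCycle)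
    (hc : x.support.card = Fintype.card α) : IsFullCycle x := by
  intro a b
  have hu : x.support = Finset.univ := Finset.card_eq_iff_eq_univ _ |>.mp hc
  have h : ∀ c, x c ≠ c := fun c => Equiv.Perm.mem_support.mp (hu ▸ Finset.mem_univ c)
  exact hx.sameCycle (h a) (h b)

/-- A `2`-element of the symmetric group on `2 ^ k` points is a full cycle, or its order divides
`2 ^ (k - 1)`. -/
theorem isCycle_or_pow_eq_one [Fintype α] [DecidableEq α] {k m : ℕ} {x : Equiv.Perm α}
    (hcard : Fintype.card α = 2 ^ (k + 1)) (hx : orderOf x = 2 ^ m) :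
    (x.IsCycle ∧ x.support.card = 2 ^ (k + 1)) ∨ x ^ 2 ^ k = 1 := by
  rw [or_iff_not_imp_right]
  intro hne
  obtain ⟨a, ha⟩ : ∃ a, (x ^ 2 ^ k) a ≠ a := by
    by_contra! h
    exact hne (Equiv.ext h)
  obtain ⟨j, hj⟩ := exists_minimalPeriod_eq_two_pow (isPGroup_zpowers_of_orderOf hx) a
  have hkj : k + 1 ≤ j := by
    by_contra! hlt
    refine ha ?_
    have := (zpow_apply_eq_self_iff x a ((2 ^ k : ℕ) : ℤ)).mpr (by
      rw [hj]; exact_mod_cast pow_dvd_pow 2 (by lia))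
    rwa [zpow_natCast] at this
  have huniv : {b | x.SameCycle a b} = Set.univ := by
    refine Set.eq_of_subset_of_ncard_le (Set.subset_univ _) ?_
    rw [Set.ncard_univ, Nat.card_eq_fintype_card, hcard, ncard_sameCycle, hj]
    exact Nat.pow_le_pow_right two_pos hkj
  have hall : ∀ b, x.SameCycle a b := fun b => huniv.ge (Set.mem_univ b)
  have hxa : x a ≠ a := fun h => ha (Equiv.Perm.pow_apply_eq_self_of_apply_eq_self h _)
  refine ⟨⟨a, hxa, fun b _ => hall b⟩, ?_⟩
  rw [← hcard, Finset.card_eq_iff_eq_univ, Finset.eq_univ_iff_forall]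
  intro b
  rw [Equiv.Perm.mem_support, Ne, ← (hall b).apply_eq_self_iff]
  exact hxa

theorem exists_minimalPeriod_eq_of_orderOf {n : ℕ} {x : Equiv.Perm α}
    (hx : orderOf x = 2 ^ (n + 1)) : ∃ d, Function.minimalPeriod x d = 2 ^ (n + 1) := by
  have h1 : x ^ 2 ^ (n + 1) = 1 := hx ▸ pow_orderOf_eq_one x
  by_contra! h
  have h2 : x ^ 2 ^ n = 1 := Equiv.ext fun a => by
    by_contra ha
    exact h a (minimalPeriod_eq_two_pow ha (by rw [h1]; rfl))
  have h3 := orderOf_dvd_of_pow_eq_one h2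
  rw [hx, Nat.pow_dvd_pow_iff_le_right (by norm_num)] at h3
  lia

theorem ncard_sameCycle_eq_ncard_compl [Finite α] {n : ℕ} {x : Equiv.Perm α} {d : α}
    (hcard : Nat.card α = 2 ^ (n + 2)) (hd : Function.minimalPeriod x d = 2 ^ (n + 1)) :
    {b | x.SameCycle d b}.ncard = {b | x.SameCycle d b}ᶜ.ncard := by
  have := Set.ncard_add_ncard_compl {b | x.SameCycle d b}
  rw [ncard_sameCycle, hd, hcard, pow_succ 2 (n + 1)] at this
  rw [ncard_sameCycle, hd]
  lia

end Main

theorem mainTheorem3 (k : ℕ) (hk : 3 ≤ k) (x : Equiv.Perm (Fin (2 ^ k)))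
    (hx : ∃ m : ℕ, orderOf x = 2 ^ m) :
    (subnormalizer x < ⊤ ↔
      (x.IsCycle ∧ x.support.card = 2 ^ k) ∨
      (orderOf x = 2 ^ (k - 1) ∧ ∃ a, x a = a)) ∧
    ((orderOf x = 2 ^ (k - 1) ∧ ∃ a, x a = a) →
      ∃ (y : Equiv.Perm (shortCyclePoints x (2 ^ (k - 1))))
        (f : shortCyclePoints x (2 ^ (k - 1)) × Equiv.Perm (Fin 2) ≃ Fin (2 ^ k)),
        (∀ a, (y a : Fin (2 ^ k)) = shortCycleProduct x (2 ^ (k - 1)) a) ∧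
        (∀ a, f (a, 1) = a) ∧
        subnormalizer x = wreathS2 (subnormalizer y) f) := by
  obtain ⟨n, rfl⟩ : ∃ n, k = n + 2 := ⟨k - 2, by lia⟩
  obtain ⟨m, hm⟩ := hx
  have hx2 := isPGroup_zpowers_of_orderOf hm
  have hcard : Nat.card (Fin (2 ^ (n + 2))) = 2 ^ (n + 2) := by simp
  rw [show n + 2 - 1 = n + 1 by lia]
  refine ⟨⟨fun hlt => ?_, ?_⟩, ?_⟩
  · by_contra! hcon
    have hx1 := (isCycle_or_pow_eq_one (by simp) hm).resolve_left fun h => hcon.1 h.1 h.2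
    refine hlt.ne (subnormalizer_eq_top (n + 1) hcard hx1 ?_)
    rw [or_iff_not_imp_left]
    exact fun hne => hcon.2 (orderOf_eq_prime_pow hne hx1)
  · rintro (⟨hcyc, hc⟩ | ⟨ho, a, ha⟩)
    · refine lt_top_iff_ne_top.mpr fun htop => not_isPGroup_two_perm (α := Fin (2 ^ (n + 2))) ?_
        (htop ▸ (isFullCycle_of_isCycle hcyc (by simpa using hc)).isPGroup_subnormalizer m
          (hm ▸ pow_orderOf_eq_one x))
      rw [hcard]
      calc 3 ≤ 2 ^ 2 := by norm_num
        _ ≤ 2 ^ (n + 2) := Nat.pow_le_pow_right two_pos (by lia)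
    · obtain ⟨d, hd⟩ := exists_minimalPeriod_eq_of_orderOf ho
      refine lt_top_iff_ne_top.mpr (subnormalizer_ne_top_of_half_cycle ha (d := d) (fun h => ?_) hx2
        (ncard_sameCycle_eq_ncard_compl hcard hd))
      have h1 : Function.minimalPeriod x d = 1 := Function.minimalPeriod_eq_one_iff_isFixedPt.mpr h
      have h2 : (1 : ℕ) < 2 ^ (n + 1) := Nat.one_lt_two_pow (by lia)
      lia
  · rintro ⟨ho, a, ha⟩
    obtain ⟨d, hd⟩ := exists_minimalPeriod_eq_of_orderOf ho
    obtain ⟨y, f, hy, hf, heq⟩ :=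
      subnormalizer_eq_wreathS2 hcard (ho ▸ pow_orderOf_eq_one x) ha hd
    exact ⟨y, f, fun b => (hy b).trans (shortCycleProduct_apply x _ b.2).symm, hf, heq⟩
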